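/- Let $d\ge 0$. For each $\beta>0$ let $0<c_\beta(0)\le c_\beta(1)\le\dots\le c_\beta(2d)$ be rates such that $\lim_{\beta\to\infty}\frac1\beta\ln c_\beta(n)=-\Gamma_{d-n}$ for $0\le n\le d$ and $\lim_{\beta\to\infty}\frac1\beta\ln c_\beta(n)=0$ for $d\le n\le 2d$, where $\Gamma_0\le\Gamma_1\le\dots\le\Gamma_d$ are real numbers. Put $\kappa_0=\Gamma_0$, $\kappa_i=\max\big(\Gamma_{i-1},\frac{\Gamma_i+i\kappa_{i-1}}{i+1}\big)$ for $1\le i\le d$, and $L_d=\frac{\Gamma_d-\kappa_d}{d}$ (with $L_0=0$). If $d\ge1$, assume $L_d>0$ (equivalently $\Gamma_{d-1}<\Gamma_d$). Attach to the sites of $\mathbb Z^d$ independent Poisson processes of rate one, with arrival times $\tau(x,i)$, $i\ge1$, and independent marks $U(x,i)$, uniform on $[0,1]$ and independent of the Poisson processes. For a finite $\Lambda\subset\mathbb Z^d$, the growth process $(\sigma_{\Lambda,t})_{t\ge0}$ with parameter $\beta$ starts from the empty configuration; an empty site $x\in\Lambda$ becomes occupied at time $t=\tau(x,i)$ if $U(x,i)\le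 c_\beta(N)$, where $N$ is the number of nearest neighbours of $x$ in $\Lambda$ that are occupied at that time; occupied sites remain occupied forever. A cluster is a connected component, for the nearest neighbour relation of $\mathbb Z^d$, of the set of occupied sites. **Theorem.** Let $L>0$ and let $\Lambda_\beta=\mathbb Z^d\cap[-\tfrac12e^{\beta L},\tfrac12e^{\beta L}]^d$ be the cubic box of sidelength $\exp(\beta L)$. Let $\kappa<\kappa_d$ and $\tau_\beta=\exp(\beta\kappa)$. Then the probability that some occupied cluster of $\sigma_{\Lambda_\beta,\tau_\beta}$ has sup-norm diameter strictly larger than $\exp(\beta L_d)$ is super-exponentially small in $\beta$, that is, $$\lim_{\beta\to\infty}\frac1\beta\ln\mathbb P\big(\exists\text{ an occupied cluster }C\text{ of }\sigma_{\Lambda_\beta,\tau_\beta}\text{ with }\operatorname{diam}_\infty C>e^{\beta L_d}\big)=-\infty ,$$ where $\ln 0=-\infty$. -/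

import Mathlib

open Filter Topology MeasureTheory ProbabilityTheory
open scoped ENNReal

namespace NucleationGrowth

/-! ### The lattice -/

/-- The sites of the lattice `ℤ^d`. The metric that Mathlib puts on this type is the one of the
supremum norm, so that `Metric.diam` is the sup-norm diameter. -/
abbrev Site (d : ℕ) : Type := Fin d → ℤ

/-- The nearest neighbour graph of `ℤ^d`. Two integer points are at Euclidean distance `1` exactly
when their coordinates differ in total by `1`. -/
def lattice (d : ℕ) : SimpleGraph (Site d) where
  Adj x y := ∑ i, |x i - y i| = 1
  symm := ⟨fun x y h => by simpa only [abs_sub_comm] using h⟩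
  loopless := ⟨fun x h => by simp at h⟩

/-- The cubic box `Λ(ℓ)` of sidelength `ℓ` centred at the origin: the integer points of
`[-ℓ/2, ℓ/2]^d`. -/
noncomputable def box (d : ℕ) (ℓ : ℝ) : Finset (Site d) :=
  Fintype.piFinset fun _ => Finset.Icc ⌈-(ℓ / 2)⌉ ⌊ℓ / 2⌋

/-- `C` is a cluster of the set `A` of occupied sites: a connected component of the subgraph of
the lattice induced on `A`. -/
def IsCluster {d : ℕ} (A C : Set (Site d)) : Prop :=
  ∃ K : ((lattice d).induce A).ConnectedComponent, C = Subtype.val '' K.supp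

/-! ### The graphical construction

A realization consists of the arrival times `τ x i` of the clock of every site `x` and of the
marks `u x i` attached to the arrivals. The index `i = 0` is the first arrival. -/

/-- The waiting times between successive arrivals. -/
def gap {d : ℕ} {Ω : Type*} (τ : Site d → ℕ → Ω → ℝ) (x : Site d) : ℕ → Ω → ℝ
  | 0 => τ x 0
  | i + 1 => fun ω => τ x (i + 1) ω - τ x i ω

/-- `τ x i` are the arrival times of independent Poisson processes of rate one attached to the
sites (the waiting times are i.i.d. exponential of parameter one), and the `U x i` are uniform on
`[0,1]`, independent of each other and of the Poisson processes. -/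
structure IsGraphicalConstruction {d : ℕ} {Ω : Type*} [MeasurableSpace Ω] (P : Measure Ω)
    (τ U : Site d → ℕ → Ω → ℝ) : Prop where
  exponential : ∀ x i, HasLaw (gap τ x i) (expMeasure 1) P
  uniform : ∀ x i, HasLaw (U x i) (volume.restrict (Set.Icc (0 : ℝ) 1)) P
  indep : iIndepFun (Sum.elim (fun p : Site d × ℕ => gap τ p.1 p.2)
    (fun p : Site d × ℕ => U p.1 p.2)) P

section Dynamics

variable {d : ℕ} (Λ : Finset (Site d)) (c : ℕ → ℝ) (τ u : Site d → ℕ → ℝ)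

/-- The chronological order of the arrivals in `Λ`. -/
def Before (e e' : Λ × ℕ) : Prop := τ e.1 e.2 < τ e'.1 e'.2

/-- The arrivals in `Λ` can be treated one after the other in chronological order. As `Λ` is
finite, this is so as soon as every clock rings finitely often in bounded time, hence almost
surely. -/
abbrev Chronological : Prop := WellFounded (Before Λ τ)

/-- The updating rule, by recursion along the chronological order: the arrival `e = (x, i)` makes
`x` occupied (unless `x` already is) when `u x i ≤ c n`, where `n` is the number of the neighbours
of `x` in `Λ` at which an earlier arrival was successful. -/
noncomputable def Success (h : Chronological Λ τ) : Λ × ℕ → Prop :=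
  WellFounded.fix h fun e rec =>
    u e.1 e.2 ≤ c (Set.ncard {y : Λ | (lattice d).Adj e.1 y ∧
      ∃ j : ℕ, ∃ hj : Before Λ τ (y, j) e, rec (y, j) hj})

/-- The set of the occupied sites of the growth process in `Λ` at time `t`, for the acceptance
probabilities `c`, started from the empty configuration, with nothing occupied outside `Λ`
(on the null event that the arrivals are not chronological, nothing is ever occupied). -/
def growth (t : ℝ) : Set (Site d) :=
  {x | ∃ (hx : x ∈ Λ) (h : Chronological Λ τ) (i : ℕ), τ x i ≤ t ∧
    Success Λ c τ u h (⟨x, hx⟩, i)}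

/-- The growth process follows the updating rule: `x` is occupied at time `t` if and only if at
some arrival time `τ x i ≤ t` the mark is at most `c n`, where `n` is the number of neighbours of
`x` occupied before time `τ x i`. -/
theorem mem_growth_iff (h : Chronological Λ τ) (t : ℝ) (x : Site d) :
    x ∈ growth Λ c τ u t ↔ x ∈ Λ ∧ ∃ i, τ x i ≤ t ∧
      u x i ≤ c (Set.ncard {y | (lattice d).Adj x y ∧
        ∃ s < τ x i, y ∈ growth Λ c τ u s}) := by
  have key : ∀ (hx : x ∈ Λ) (i : ℕ), Success Λ c τ u h (⟨x, hx⟩, i) ↔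
      u x i ≤ c (Set.ncard {y | (lattice d).Adj x y ∧
        ∃ s < τ x i, y ∈ growth Λ c τ u s}) := by
    intro hx i
    have hs : {y | (lattice d).Adj x y ∧ ∃ s < τ x i, y ∈ growth Λ c τ u s} =
        Subtype.val '' {y : Λ | (lattice d).Adj x y ∧
          ∃ j : ℕ, ∃ _ : Before Λ τ (y, j) (⟨x, hx⟩, i), Success Λ c τ u h (y, j)} := by
      ext y
      constructor
      · rintro ⟨hadj, s, hs, hy, h', j, hj, hsucc⟩
        exact ⟨⟨y, hy⟩, ⟨hadj, j, lt_of_le_of_lt hj hs, hsucc⟩, rfl⟩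
      · rintro ⟨y, ⟨hadj, j, hj, hsucc⟩, rfl⟩
        exact ⟨hadj, τ y j, hj, y.2, h, j, le_rfl, hsucc⟩
    rw [hs, Set.ncard_image_of_injective _ Subtype.val_injective]
    exact Iff.of_eq (WellFounded.fix_eq h _ _)
  constructor
  · rintro ⟨hx, h', i, hi, hsucc⟩
    exact ⟨hx, i, hi, (key hx i).1 hsucc⟩
  · rintro ⟨hx, i, hi, hle⟩
    exact ⟨hx, h, i, hi, (key hx i).2 hle⟩

end Dynamics

/-! ### Rates, critical constants, super-exponential smallness -/

/-- The hypothesis on the rates `c β n`, `0 ≤ n ≤ 2d`, with the activation energies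
`Γ 0 ≤ ⋯ ≤ Γ d`. -/
structure RateHypothesis (d : ℕ) (c : ℝ → ℕ → ℝ) (Γ : ℕ → ℝ) : Prop where
  pos : ∀ β > 0, ∀ n ≤ 2 * d, 0 < c β n
  mono : ∀ β > 0, ∀ m n, m ≤ n → n ≤ 2 * d → c β m ≤ c β n
  limit_low : ∀ n ≤ d,
    Tendsto (fun β : ℝ => 1 / β * Real.log (c β n)) atTop (𝓝 (-Γ (d - n)))
  limit_high : ∀ n, d ≤ n → n ≤ 2 * d →
    Tendsto (fun β : ℝ => 1 / β * Real.log (c β n)) atTop (𝓝 0)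
  energies : ∀ m n, m ≤ n → n ≤ d → Γ m ≤ Γ n

/-- The critical constants: `κ_0 = Γ_0` and
`κ_i = max (Γ_{i-1}) ((Γ_i + i κ_{i-1}) / (i + 1))` for `i ≥ 1`. -/
noncomputable def kappa (Γ : ℕ → ℝ) : ℕ → ℝ
  | 0 => Γ 0
  | i + 1 => max (Γ i) ((Γ (i + 1) + (i + 1) * kappa Γ i) / (i + 2))

/-- The critical exponent `L_d = (Γ_d - κ_d) / d`, with `L_0 = 0`. -/
noncomputable def critL (Γ : ℕ → ℝ) (d : ℕ) : ℝ := (Γ d - kappa Γ d) / d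

/-- The probabilities `p β` are super-exponentially small: `(1/β) ln (p β) → -∞` as `β → ∞`,
where `ln 0 = -∞`. -/
def SES (p : ℝ → ℝ≥0∞) : Prop :=
  Tendsto (fun β : ℝ => ((1 / β : ℝ) : EReal) * ENNReal.log (p β)) atTop (𝓝 ⊥)

end NucleationGrowth

namespace NucleationGrowth

/-! ### Linked sites -/

/-! A cluster seen at time `exp (β κ)` has been filled from inside: each of its sites was helped
only by earlier neighbours in the same cluster (`hasLarge_of_isCluster`). It therefore suffices to
show that connected sets filled from inside are rarely large (`HasLarge`). This is `largeUnlikely`,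
proved by induction on the dimension, uniformly over environments with product bounds at distinct
sites.

In dimension `n + 1`, let `l` be of order `exp (β lam)`. Stopping the filling in time gives a set of
diameter between `l` and `2 l + 2` (`IsSchedule.exists_intermediate`). If `(n + 1) lam + κ < Γ (n +
1)`, then `h` seeds (sites occupied without any occupied neighbour) in such a volume cost a factor
`exp (-c β)` each, so a large constant `h` beats any prescribed exponential rate. With fewer seeds,
some strip contains none. Time is cut into `J`, about `exp (β lam)`, slots; to fill the strip, the
occupied region has to advance by `h` layers during one of them (`IsSchedule.exists_isCrossing`).

In each of these layers some site is occupied with a single occupied neighbour. The projection of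
the advancing piece along the direction of the crossing is filled from inside in dimension `n` with
one neighbour granted, so the energies `Γ (n + 1 - m)` become `Γ (n - m)`
(`IsCrossing.exists_isSchedule_image`, `IsEnvironment.columns`). A slot lasts at most `exp (β (κ -
lam))`. If `κ - lam < kappa Γ n`, the induction hypothesis confines the projection to diameter of
order `exp (β lam₁)` with `n lam₁ ≤ Γ n - kappa Γ n`, and `h` hits of energy `Γ n` in that volume
are again too costly.

Both conditions on `lam` can be met when `κ < (Γ (n + 1) + (n + 1) kappa Γ n) / (n + 2)`. When `κ <
Γ n`, hits with one neighbour are already too rare in a bounded cuboid, and `lam = 0` works. These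
two cases are the two terms of the maximum in `kappa`. -/

/-- `x` and `y` are joined by a nearest neighbour path in `C`. -/
def Linked {n : ℕ} (C : Finset (Site n)) : Site n → Site n → Prop :=
  Relation.ReflTransGen fun x y => x ∈ C ∧ y ∈ C ∧ (lattice n).Adj x y

/-- Any two sites of `C` are joined by a path in `C`. -/
def IsLinked {n : ℕ} (C : Finset (Site n)) : Prop :=
  ∀ x ∈ C, ∀ y ∈ C, Linked C x y

open Classical in
/-- The sites of `C` which are joined to `x` by a path in `C`. -/
noncomputable def component {n : ℕ} (C : Finset (Site n)) (x : Site n) : Finset (Site n) :=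
  C.filter (Linked C x)

section Linked

variable {n : ℕ} {C D : Finset (Site n)} {x y z : Site n}

theorem Linked.symm (h : Linked C x y) : Linked C y x := by
  induction h with
  | refl => exact .refl
  | tail _ h ih => exact .head ⟨h.2.1, h.1, h.2.2.symm⟩ ih

theorem mem_component : y ∈ component C x ↔ y ∈ C ∧ Linked C x y := by
  simp [component]

theorem component_subset : component C x ⊆ C := fun _ h => (mem_component.1 h).1

theorem mem_component_self (hx : x ∈ C) : x ∈ component C x := mem_component.2 ⟨hx, .refl⟩

theorem mem_component_of_adj (hy : y ∈ component C x) (hz : z ∈ C) (h : (lattice n).Adj y z) :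
    z ∈ component C x :=
  mem_component.2 ⟨hz, (mem_component.1 hy).2.tail ⟨component_subset hy, hz, h⟩⟩

theorem linked_component (h : Linked C x y) : Linked (component C x) x y := by
  induction h with
  | refl => exact .refl
  | tail hl h ih =>
    exact ih.tail ⟨mem_component.2 ⟨h.1, hl⟩, mem_component.2 ⟨h.2.1, hl.tail h⟩, h.2.2⟩

theorem isLinked_component : IsLinked (component C x) := fun _ hy _ hz =>
  (linked_component (mem_component.1 hy).2).symm.trans (linked_component (mem_component.1 hz).2)

/-- Cut the path just before its first visit to `z`. -/
theorem Linked.exists_adj_of_ne (h : Linked C x z) (hne : x ≠ z) :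
    ∃ y ∈ C.erase z, (lattice n).Adj y z ∧ Linked (C.erase z) x y := by
  induction h using Relation.ReflTransGen.head_induction_on with
  | refl => exact absurd rfl hne
  | @head u v hxy _ ih =>
    by_cases hv : v = z
    · subst hv
      exact ⟨u, Finset.mem_erase.2 ⟨hne, hxy.1⟩, hxy.2.2, .refl⟩
    · obtain ⟨w, hw, hwz, hl⟩ := ih hv
      exact ⟨w, hw, hwz, .head ⟨Finset.mem_erase.2 ⟨hne, hxy.1⟩,
        Finset.mem_erase.2 ⟨hv, hxy.2.1⟩, hxy.2.2⟩ hl⟩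

theorem abs_sub_le_one_of_adj (h : (lattice n).Adj x y) (i : Fin n) : |x i - y i| ≤ 1 := by
  have h' : ∑ i, |x i - y i| = 1 := h
  rw [← h']
  exact Finset.single_le_sum (f := fun i => |x i - y i|) (fun _ _ => abs_nonneg _)
    (Finset.mem_univ i)

theorem dist_le_one_of_adj (h : (lattice n).Adj x y) : dist x y ≤ 1 := by
  refine (dist_pi_le_iff zero_le_one).2 fun i => ?_
  rw [Int.dist_eq]
  exact_mod_cast abs_sub_le_one_of_adj h i

/-- A discrete intermediate value theorem: a coordinate changes by at most one per step. -/
theorem Linked.exists_coord_eq (h : Linked C x y) (hy : y ∈ C) (i : Fin n) {m : ℤ}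
    (hm : m ≤ y i) (hx : x i ≤ m) : ∃ w ∈ C, w i = m := by
  induction h with
  | refl => exact ⟨x, hy, le_antisymm hx hm⟩
  | @tail u v _ h ih =>
    by_cases hu : m ≤ u i
    · exact ih h.1 hu
    · have := (abs_le.1 (abs_sub_le_one_of_adj h.2.2 i)).1
      exact ⟨v, hy, by omega⟩

end Linked

/-! ### Schedules -/

open Classical in
/-- The neighbours of `x` in `C` which become occupied before `x`. -/
noncomputable def earlier {n : ℕ} (C : Finset (Site n)) (t : Site n → ℝ) (x : Site n) :
    Finset (Site n) :=
  C.filter fun y => (lattice n).Adj x y ∧ t y < t x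

/-- If `X x m` are the times at which `x` may become occupied as soon as it has `m` occupied
neighbours, then `t` describes how `C` may be filled during `(a, b]` without help from outside. -/
structure IsSchedule {n : ℕ} (X : Site n → ℕ → Set ℝ) (a b : ℝ) (C : Finset (Site n))
    (t : Site n → ℝ) : Prop where
  mem : ∀ x ∈ C, t x ∈ X x (earlier C t x).card
  time : ∀ x ∈ C, t x ∈ Set.Ioc a b

section Schedule

variable {n : ℕ} {X : Site n → ℕ → Set ℝ} {a b : ℝ} {C D : Finset (Site n)} {t : Site n → ℝ}
  {x y : Site n}

theorem mem_earlier : y ∈ earlier C t x ↔ y ∈ C ∧ (lattice n).Adj x y ∧ t y < t x := by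
  simp [earlier]

/-- A part that contains all the earlier neighbours of its sites keeps the same neighbour counts.
Components have this property, and so does a set deprived of a last site, which helps no other. -/
theorem IsSchedule.of_earlier_subset (h : IsSchedule X a b C t) (hD : D ⊆ C)
    (he : ∀ x ∈ D, earlier C t x ⊆ D) : IsSchedule X a b D t where
  mem x hx := by
    have : earlier D t x = earlier C t x := by
      ext y
      refine ⟨fun hy => ?_, fun hy => ?_⟩
      · exact mem_earlier.2 ⟨hD (mem_earlier.1 hy).1, (mem_earlier.1 hy).2⟩
      · exact mem_earlier.2 ⟨he x hx hy, (mem_earlier.1 hy).2⟩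
    rw [this]
    exact h.mem x (hD hx)
  time x hx := h.time x (hD hx)

theorem IsSchedule.component (h : IsSchedule X a b C t) (x : Site n) :
    IsSchedule X a b (component C x) t :=
  h.of_earlier_subset component_subset fun _ hy _ hz =>
    mem_component_of_adj hy (mem_earlier.1 hz).1 (mem_earlier.1 hz).2.1

theorem IsSchedule.erase (h : IsSchedule X a b C t) {z : Site n} (hz : ∀ x ∈ C, t x ≤ t z) :
    IsSchedule X a b (C.erase z) t := by
  refine h.of_earlier_subset (Finset.erase_subset _ _) fun x hx y hy => ?_
  have hy := mem_earlier.1 hy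
  refine Finset.mem_erase.2 ⟨?_, hy.1⟩
  rintro rfl
  exact absurd hy.2.2 (not_lt.2 (hz x (Finset.mem_of_mem_erase hx)))

/-- A set of large diameter which is filled from inside contains a connected one, also filled from
inside, of a prescribed order of diameter. -/
theorem IsSchedule.exists_intermediate {l : ℝ} (hl : 0 ≤ l) (h : IsSchedule X a b C t)
    (hx : x ∈ C) (hxy : Linked C x y) (hlt : l < dist x y) :
    ∃ D ⊆ C, IsSchedule X a b D t ∧ IsLinked D ∧ (∀ u ∈ D, ∀ v ∈ D, dist u v ≤ 2 * l + 2) ∧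
      ∃ u ∈ D, ∃ v ∈ D, l < dist u v := by
  induction hN : C.card using Nat.strong_induction_on generalizing C x y with
  | _ N ih =>
  set E := NucleationGrowth.component C x with hE
  have hxE : x ∈ E := mem_component_self hx
  obtain ⟨z, hz, hzmax⟩ := E.exists_max_image t ⟨x, hxE⟩
  have hs := (h.component x).erase hzmax
  -- Remove the last occupied site `z`. If a large connected piece survives, recurse on it.
  -- Otherwise all the pieces have diameter at most `l` and are joined only through `z`, so that `E`
  -- lies within `l + 1` of `z`.
  by_cases hfar : ∃ u ∈ E.erase z, ∃ v ∈ E.erase z, Linked (E.erase z) u v ∧ l < dist u v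
  · obtain ⟨u, hu, v, _, huv, hluv⟩ := hfar
    have hlt' : (E.erase z).card < N := hN ▸
      (Finset.card_erase_lt_of_mem hz).trans_le (Finset.card_le_card component_subset)
    obtain ⟨D, hD, hD'⟩ := ih _ hlt' hs hu huv hluv rfl
    exact ⟨D, hD.trans ((Finset.erase_subset _ _).trans component_subset), hD'⟩
  · push Not at hfar
    have hnear : ∀ w ∈ E, dist w z ≤ l + 1 := by
      intro w hw
      by_cases hwz : w = z
      · subst hwz
        simp only [dist_self]
        positivity
      · obtain ⟨v, hv, hadj, hlk⟩ := (isLinked_component w hw z hz).exists_adj_of_ne hwz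
        have h1 := hfar w (Finset.mem_erase.2 ⟨hwz, hw⟩) v hv hlk
        have h2 := dist_le_one_of_adj hadj
        linarith [dist_triangle w v z]
    have hyE : y ∈ E := by
      refine mem_component.2 ⟨?_, hxy⟩
      rcases hxy.cases_tail with h | ⟨_, _, h⟩
      · exact h ▸ hx
      · exact h.2.1
    refine ⟨E, component_subset, h.component x, isLinked_component, fun u hu v hv => ?_,
      x, hxE, y, hyE, hlt⟩
    linarith [dist_triangle_right u v z, hnear u hu, hnear v hv]

end Schedule

/-! ### Crossings -/

/-- `x` is the first site of its layer orthogonal to the direction `i` to become occupied; the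
preceding `h` layers on the side `s = ±1` are empty at time `a` and contain no seed. -/
structure IsCrossing {n : ℕ} (C : Finset (Site n)) (t : Site n → ℝ) (i : Fin n) (s : ℤ) (h : ℕ)
    (a b : ℝ) (x : Site n) : Prop where
  sign : s = 1 ∨ s = -1
  mem : x ∈ C
  time : t x ∈ Set.Ioc a b
  nonempty : (earlier C t x).Nonempty
  prior : ∀ w ∈ C, t w < t x → s * x i - h ≤ s * w i → s * w i ≤ s * x i + 1 →
    s * w i < s * x i ∧ a < t w ∧ (earlier C t w).Nonempty

open Classical in
/-- The part of the `h` layers before the site `x` which is occupied before `x`, and `x`. -/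
noncomputable def slab {n : ℕ} (C : Finset (Site n)) (t : Site n → ℝ) (i : Fin n) (s : ℤ) (h : ℕ)
    (x : Site n) : Finset (Site n) :=
  C.filter fun w => w = x ∨ (t w < t x ∧ s * x i - h ≤ s * w i ∧ s * w i ≤ s * x i + 1)

theorem adj_cases {n : ℕ} {w z : Site (n + 1)} (h : (lattice (n + 1)).Adj w z) (i : Fin (n + 1)) :
    ((w i = z i + 1 ∨ z i = w i + 1) ∧ i.removeNth w = i.removeNth z) ∨
      (w i = z i ∧ (lattice n).Adj (i.removeNth w) (i.removeNth z)) := by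
  have h' : ∑ j, |w j - z j| = 1 := h
  rw [Fin.sum_univ_succAbove _ i] at h'
  have h0 : 0 ≤ ∑ j : Fin n, |w (i.succAbove j) - z (i.succAbove j)| :=
    Finset.sum_nonneg fun _ _ => abs_nonneg _
  by_cases hi : w i = z i
  · refine Or.inr ⟨hi, ?_⟩
    change ∑ j : Fin n, |w (i.succAbove j) - z (i.succAbove j)| = 1
    simpa [hi] using h'
  · have h1 : 0 < |w i - z i| := abs_pos.2 (sub_ne_zero.2 hi)
    refine Or.inl ⟨?_, ?_⟩
    · have : |w i - z i| = 1 := by omega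
      rcases (abs_eq zero_le_one).1 this with h | h <;> omega
    · have h2 : ∑ j : Fin n, |w (i.succAbove j) - z (i.succAbove j)| = 0 := by omega
      funext j
      have := (Finset.sum_eq_zero_iff_of_nonneg fun _ _ => abs_nonneg _).1 h2 j (Finset.mem_univ j)
      exact sub_eq_zero.1 (abs_eq_zero.1 this)

theorem site_ext {n : ℕ} {w z : Site (n + 1)} (i : Fin (n + 1)) (h : w i = z i)
    (h' : i.removeNth w = i.removeNth z) : w = z := by
  rw [← Fin.insertNth_self_removeNth i w, ← Fin.insertNth_self_removeNth i z, h, h']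

section Crossing

variable {n : ℕ} {X : Site (n + 1) → ℕ → Set ℝ} {a b a' b' : ℝ} {C : Finset (Site (n + 1))}
  {t : Site (n + 1) → ℝ} {i : Fin (n + 1)} {s : ℤ} {h : ℕ} {x w z : Site (n + 1)}

theorem mem_slab : w ∈ slab C t i s h x ↔
    w ∈ C ∧ (w = x ∨ (t w < t x ∧ s * x i - h ≤ s * w i ∧ s * w i ≤ s * x i + 1)) := by
  simp [slab]

namespace IsCrossing

variable (hc : IsCrossing C t i s h a b x)
include hc

theorem mem_slab_self : x ∈ slab C t i s h x := mem_slab.2 ⟨hc.mem, .inl rfl⟩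

theorem le_of_mem_slab (hw : w ∈ slab C t i s h x) :
    s * x i - h ≤ s * w i ∧ s * w i ≤ s * x i ∧ t w ≤ t x := by
  obtain ⟨hwC, rfl | ⟨h1, h2, h3⟩⟩ := mem_slab.1 hw
  · refine ⟨by omega, le_rfl, le_rfl⟩
  · exact ⟨h2, (hc.prior w hwC h1 h2 h3).1.le, h1.le⟩

theorem earlier_nonempty (hw : w ∈ slab C t i s h x) : (earlier C t w).Nonempty := by
  obtain ⟨hwC, rfl | ⟨h1, h2, h3⟩⟩ := mem_slab.1 hw
  · exact hc.nonempty
  · exact (hc.prior w hwC h1 h2 h3).2.2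

theorem time_mem (hw : w ∈ slab C t i s h x) : t w ∈ Set.Ioc a b := by
  obtain ⟨hwC, rfl | ⟨h1, h2, h3⟩⟩ := mem_slab.1 hw
  · exact hc.time
  · exact ⟨(hc.prior w hwC h1 h2 h3).2.1, h1.le.trans hc.time.2⟩

/-- The earlier neighbours of a site of the component stay in the component unless they are below
the slab. -/
theorem mem_component_of_earlier (hw : w ∈ component (slab C t i s h x) x)
    (hz : z ∈ earlier C t w) (hl : s * x i - h ≤ s * z i) :
    z ∈ component (slab C t i s h x) x := by
  have hz := mem_earlier.1 hz
  have hw' := hc.le_of_mem_slab (component_subset hw)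
  -- A neighbour of a slab site is at most one layer beyond `x`. This is why the slab and `prior`
  -- look one layer past `x`, although `prior` then shows that nothing there is earlier than `x`.
  refine mem_component_of_adj hw (mem_slab.2 ⟨hz.1, .inr ⟨hz.2.2.trans_le hw'.2.2, hl, ?_⟩⟩)
    hz.2.1
  have := abs_le.1 (abs_sub_le_one_of_adj hz.2.1 i)
  rcases hc.sign with rfl | rfl <;> omega

/-- In each of the layers, some site becomes occupied when it has at most one occupied
neighbour. -/
theorem exists_card_le_one (hX : ∀ y, Monotone (X y)) (hs : IsSchedule X a' b' C t) {k : ℕ}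
    (hk : k < h) : ∃ w ∈ component (slab C t i s h x) x, s * w i = s * x i - k ∧ t w ∈ X w 1 := by
  classical
  set B := component (slab C t i s h x) x with hB
  -- Take the earliest site of the component at or beyond the `k`-th layer below `x`: its earlier
  -- neighbours all lie before that layer, so there is only one, directly behind it.
  obtain ⟨w, hw, hmin⟩ := (B.filter fun w => s * x i - k ≤ s * w i).exists_min_image t
    ⟨x, Finset.mem_filter.2 ⟨mem_component_self hc.mem_slab_self, by omega⟩⟩
  obtain ⟨hwB, hwk⟩ := Finset.mem_filter.1 hw
  have hdown : ∀ z ∈ earlier C t w, s * z i < s * x i - k := by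
    intro z hz
    by_contra! hcon
    have := hmin z (Finset.mem_filter.2
      ⟨hc.mem_component_of_earlier hwB hz (by omega), hcon⟩)
    exact absurd (mem_earlier.1 hz).2.2 (not_lt.2 this)
  have hform : ∀ z ∈ earlier C t w,
      s * w i = s * x i - k ∧ s * z i = s * w i - 1 ∧ i.removeNth w = i.removeNth z := by
    intro z hz
    have h1 := hdown z hz
    rcases adj_cases (mem_earlier.1 hz).2.1 i with ⟨h2, h3⟩ | ⟨h2, _⟩
    · refine ⟨?_, ?_, h3⟩ <;> rcases hc.sign with rfl | rfl <;> omega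
    · rw [h2] at hwk
      omega
  obtain ⟨z, hz⟩ := hc.earlier_nonempty (component_subset hwB)
  refine ⟨w, hwB, (hform z hz).1, hX w ?_ (hs.mem w (mem_slab.1 (component_subset hwB)).1)⟩
  refine Finset.card_le_one.2 fun u hu v hv => site_ext i ?_ ?_
  · have := (hform u hu).2.1
    have := (hform v hv).2.1
    rcases hc.sign with rfl | rfl <;> omega
  · rw [← (hform u hu).2.2, ← (hform v hv).2.2]

/-- The projection of the component along the direction of the crossing is filled from inside when
one occupied neighbour is granted to all sites. -/
theorem exists_isSchedule_image [DecidableEq (Site n)] (hX : ∀ y, Monotone (X y))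
    (hs : IsSchedule X a' b' C t) :
    ∃ t', IsSchedule (fun y m => {r | ∃ w, i.removeNth w = y ∧ |w i - x i| ≤ h ∧ r ∈ X w (m + 1)})
      a b ((component (slab C t i s h x) x).image i.removeNth) t' := by
  classical
  set B := component (slab C t i s h x) x with hB
  -- A column counts as occupied from the first time one of its sites in `B` is; the value off the
  -- projection is irrelevant.
  have hcol : ∀ y, ∃ r : ℝ, ∀ w₀ ∈ B, i.removeNth w₀ = y →
      ∃ w ∈ B, i.removeNth w = y ∧ r = t w ∧ ∀ v ∈ B, i.removeNth v = y → t w ≤ t v := by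
    intro y
    by_cases hy : ∃ w₀ ∈ B, i.removeNth w₀ = y
    · obtain ⟨w₀, hw₀, hy₀⟩ := hy
      obtain ⟨w, hw, hmin⟩ := (B.filter fun w => i.removeNth w = y).exists_min_image t
        ⟨w₀, Finset.mem_filter.2 ⟨hw₀, hy₀⟩⟩
      obtain ⟨hwB, hwy⟩ := Finset.mem_filter.1 hw
      exact ⟨t w, fun _ _ _ => ⟨w, hwB, hwy, rfl, fun v hv hvy =>
        hmin v (Finset.mem_filter.2 ⟨hv, hvy⟩)⟩⟩
    · exact ⟨0, fun w hw hwy => absurd ⟨w, hw, hwy⟩ hy⟩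
  choose t' ht' using hcol
  have hle : ∀ v ∈ B, t' (i.removeNth v) ≤ t v := by
    intro v hv
    obtain ⟨w, _, _, hw3, hw4⟩ := ht' _ v hv rfl
    exact hw3 ▸ hw4 v hv rfl
  refine ⟨t', ⟨fun y hy => ?_, fun y hy => ?_⟩⟩
  · obtain ⟨w₀, hw₀, hwy₀⟩ := Finset.mem_image.1 hy
    obtain ⟨w, hw, rfl, hw3, hw4⟩ := ht' y w₀ hw₀ hwy₀
    have hwl := hc.le_of_mem_slab (component_subset hw)
    refine ⟨w, rfl, ?_, ?_⟩
    · rw [abs_le]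
      rcases hc.sign with rfl | rfl <;> constructor <;> omega
    rw [hw3]
    refine hX w ?_ (hs.mem w (mem_slab.1 (component_subset hw)).1)
    -- For the first site `w` of its column, an earlier neighbour in that column can only be the one
    -- just below the slab: this is the granted neighbour. The others project injectively to earlier
    -- neighbours of the column.
    set up := (earlier C t w).filter fun z => i.removeNth z = i.removeNth w
    set side := (earlier C t w).filter fun z => ¬ i.removeNth z = i.removeNth w
    have hsum : up.card + side.card = (earlier C t w).card :=
      Finset.card_filter_add_card_filter_not _
    have hup : up.card ≤ 1 := by
      have hform : ∀ z ∈ up, s * z i = s * w i - 1 := by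
        intro z hz
        obtain ⟨hz, hzw⟩ := Finset.mem_filter.1 hz
        by_contra hne
        have hin : z ∈ B := by
          refine hc.mem_component_of_earlier hw hz ?_
          have := abs_le.1 (abs_sub_le_one_of_adj (mem_earlier.1 hz).2.1 i)
          rcases hc.sign with rfl | rfl <;> omega
        exact absurd (mem_earlier.1 hz).2.2 (not_lt.2 (hw4 z hin hzw))
      refine Finset.card_le_one.2 fun u hu v hv => site_ext i ?_ ?_
      · have := hform u hu
        have := hform v hv
        rcases hc.sign with rfl | rfl <;> omega
      · rw [(Finset.mem_filter.1 hu).2, (Finset.mem_filter.1 hv).2]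
    have hside : side.card ≤ (earlier (B.image i.removeNth) t' (i.removeNth w)).card := by
      have hcases : ∀ z ∈ side, z ∈ earlier C t w ∧ w i = z i ∧
          (lattice n).Adj (i.removeNth w) (i.removeNth z) := by
        intro z hz
        obtain ⟨hz, hzw⟩ := Finset.mem_filter.1 hz
        rcases adj_cases (mem_earlier.1 hz).2.1 i with ⟨_, h3⟩ | h2
        · exact absurd h3.symm hzw
        · exact ⟨hz, h2⟩
      refine Finset.card_le_card_of_injOn i.removeNth (fun z hz => ?_) fun u hu v hv huv => ?_
      · obtain ⟨hz, hzi, hadj⟩ := hcases z hz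
        have hin : z ∈ B := hc.mem_component_of_earlier hw hz (hzi ▸ hwl.1)
        refine mem_earlier.2 ⟨Finset.mem_image_of_mem _ hin, hadj, ?_⟩
        rw [hw3]
        exact (hle z hin).trans_lt (mem_earlier.1 hz).2.2
      · exact site_ext i ((hcases u hu).2.1.symm.trans (hcases v hv).2.1) huv
    omega
  · obtain ⟨w₀, hw₀, hwy₀⟩ := Finset.mem_image.1 hy
    obtain ⟨w, hw, _, hw3, _⟩ := ht' y w₀ hw₀ hwy₀
    exact hw3 ▸ hc.time_mem (component_subset hw)

end IsCrossing

theorem IsLinked.image_removeNth [DecidableEq (Site n)] {B : Finset (Site (n + 1))}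
    (hB : IsLinked B) (i : Fin (n + 1)) : IsLinked (B.image i.removeNth) := by
  intro y hy z hz
  obtain ⟨u, hu, rfl⟩ := Finset.mem_image.1 hy
  obtain ⟨v, hv, rfl⟩ := Finset.mem_image.1 hz
  have := hB u hu v hv
  clear hy hz hu hv
  induction this with
  | refl => exact .refl
  | tail _ h ih =>
    rcases adj_cases h.2.2 i with ⟨_, h3⟩ | ⟨_, h3⟩
    · rwa [← h3]
    · exact ih.tail ⟨Finset.mem_image_of_mem _ h.1, Finset.mem_image_of_mem _ h.2.1, h3⟩

end Crossing

/-! ### A long connected set with few seeds has a crossing -/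

section Deterministic

variable {n : ℕ} {X : Site n → ℕ → Set ℝ} {a b : ℝ} {C : Finset (Site n)} {t : Site n → ℝ}

/-- Without crossings, the occupied region gains at most `h` layers from either side of the
seed-free strip per time slot. After `J` slots the middle is still empty, whereas a connected set
reaching both sides must meet it. -/
theorem IsSchedule.exists_isCrossing_of_gap (hs : IsSchedule X a b C t) (hC : IsLinked C)
    {i : Fin n} {lo hi : ℤ} {J h : ℕ} (hgap : lo + 2 * (J * h) + 2 < hi)
    (hseed : ∀ w ∈ C, lo < w i → w i < hi → (earlier C t w).Nonempty)
    {u v : Site n} (hu : u ∈ C) (hv : v ∈ C) (hul : u i ≤ lo) (hvh : hi ≤ v i)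
    {T : ℕ → ℝ} (hT0 : T 0 ≤ a) (hTJ : b ≤ T J) :
    ∃ j < J, ∃ s x, IsCrossing C t i s h (T j) (T (j + 1)) x := by
  classical
  by_contra! hno
  have inv : ∀ j : ℕ, j ≤ J → ∀ w ∈ C, lo + j * h < w i → w i < hi - j * h → T j < t w := by
    intro j
    induction j with
    | zero => exact fun _ w hw _ _ => hT0.trans_lt (hs.time w hw).1
    | succ j ih =>
      intro hj w hw hlw hwh
      by_contra! hle
      have ih := ih (by omega)
      have hjJ : ((j : ℤ) + 1) * h ≤ J * h := by
        exact_mod_cast Nat.mul_le_mul_right h hj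
      push_cast at hlw hwh
      -- The first site to enter the narrower strip too early. It is no seed, and its earlier
      -- neighbour tells from which side it was reached, hence the sign `s`. The margin `2` in
      -- `hgap` keeps the opposite front away from the layer after `x`.
      obtain ⟨x, hx, hmin⟩ := (C.filter fun w => lo + (j + 1) * h < w i ∧
        w i < hi - (j + 1) * h).exists_min_image t ⟨w, Finset.mem_filter.2 ⟨hw, hlw, hwh⟩⟩
      obtain ⟨hxC, hxl, hxh⟩ := Finset.mem_filter.1 hx
      have hxt : t x ≤ T (j + 1) :=
        (hmin w (Finset.mem_filter.2 ⟨hw, hlw, hwh⟩)).trans hle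
      have hout : ∀ y ∈ C, t y < t x → y i ≤ lo + (j + 1) * h ∨ hi - (j + 1) * h ≤ y i := by
        intro y hy hyt
        by_contra! hcon
        exact absurd hyt (not_lt.2 (hmin y (Finset.mem_filter.2 ⟨hy, hcon.1, hcon.2⟩)))
      have hjh : ((j : ℤ) + 1) * h = j * h + h := by ring
      have hjh0 : 0 ≤ (j : ℤ) * h := by positivity
      rw [hjh] at hjJ hxl hxh
      simp only [hjh] at hout
      generalize (j : ℤ) * h = q at *
      generalize (J : ℤ) * h = r at *
      obtain ⟨y, hy⟩ := hseed x hxC (by omega) (by omega)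
      have hy' := mem_earlier.1 hy
      have hyx := abs_le.1 (abs_sub_le_one_of_adj hy'.2.1 i)
      have hxT : t x ∈ Set.Ioc (T j) (T (j + 1)) := ⟨ih x hxC (by omega) (by omega), hxt⟩
      rcases hout y hy'.1 hy'.2.2 with hyo | hyo
      · refine hno j hj 1 x ⟨.inl rfl, hxC, hxT, ⟨y, hy⟩, fun z hz hzt hz1 hz2 => ?_⟩
        have := hout z hz hzt
        exact ⟨by omega, ih z hz (by omega) (by omega), hseed z hz (by omega) (by omega)⟩
      · refine hno j hj (-1) x ⟨.inr rfl, hxC, hxT, ⟨y, hy⟩, fun z hz hzt hz1 hz2 => ?_⟩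
        have := hout z hz hzt
        exact ⟨by omega, ih z hz (by omega) (by omega), hseed z hz (by omega) (by omega)⟩
  have hJ0 : 0 ≤ (J : ℤ) * h := by positivity
  obtain ⟨w, hw, hwi⟩ := (hC u hu v hv).exists_coord_eq hv i (m := lo + J * h + 1)
    (by omega) (by omega)
  exact absurd (inv J le_rfl w hw (by omega) (by omega)) (not_lt.2 ((hs.time w hw).2.trans hTJ))

open Classical in
/-- The sites of `C` which become occupied without any occupied neighbour. -/
noncomputable def seeds (C : Finset (Site n)) (t : Site n → ℝ) : Finset (Site n) :=
  C.filter fun w => earlier C t w = ∅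

/-- Pigeonhole: fewer than `K` points cannot meet `K` disjoint consecutive strips. -/
theorem exists_gap {S : Finset (Site n)} {K : ℕ} (hS : S.card < K) (i : Fin n) (l g : ℤ)
    (hg : 0 ≤ g) : ∃ k < K, ∀ w ∈ S, l + k * g < w i → ¬ w i < l + (k + 1) * g := by
  by_contra! hcon
  choose! f hfS hfl hfh using hcon
  obtain ⟨k, hk, k', hk', hne, heq⟩ := Finset.exists_ne_map_eq_of_card_lt_of_maps_to
    (s := Finset.range K) (t := S) (f := f) (by simpa using hS)
    (fun k hk => hfS k (Finset.mem_range.1 hk))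
  have key : ∀ k k' : ℕ, k < K → k' < K → k < k' → f k ≠ f k' := by
    intro k k' hk hk' hlt heq
    have h1 := hfh k hk
    have h2 := hfl k' hk'
    rw [heq] at h1
    have : ((k : ℤ) + 1) * g ≤ k' * g := mul_le_mul_of_nonneg_right (by omega) hg
    omega
  rw [Finset.mem_range] at hk hk'
  rcases lt_or_gt_of_ne hne with h | h
  · exact key k k' hk hk' h heq
  · exact key k' k hk' hk h heq.symm

/-- In a direction where the set is long enough, cut `K` strips of width `2 J h + 3`; one of them
contains no seed. -/
theorem IsSchedule.exists_isCrossing (hs : IsSchedule X a b C t) (hC : IsLinked C) {J h K : ℕ}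
    (hK : (seeds C t).card < K) {u v : Site n} (hu : u ∈ C) (hv : v ∈ C)
    (huv : (K : ℝ) * (2 * (J * h) + 3) < dist u v) {T : ℕ → ℝ} (hT0 : T 0 ≤ a) (hTJ : b ≤ T J) :
    ∃ i, ∃ j < J, ∃ s x, IsCrossing C t i s h (T j) (T (j + 1)) x := by
  obtain ⟨i, hi⟩ : ∃ i, (K : ℤ) * (2 * (J * h) + 3) < |u i - v i| := by
    by_contra! hcon
    refine absurd huv (not_lt.2 ((dist_pi_le_iff (by positivity)).2 fun i => ?_))
    rw [Int.dist_eq]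
    exact_mod_cast hcon i
  have key : ∀ u ∈ C, ∀ v ∈ C, (K : ℤ) * (2 * (J * h) + 3) < v i - u i →
      ∃ j < J, ∃ s x, IsCrossing C t i s h (T j) (T (j + 1)) x := by
    intro u hu v hv huv
    obtain ⟨k, hk, hgap⟩ := exists_gap hK i (u i) (2 * (J * h) + 3) (by positivity)
    have h1 : 0 ≤ (k : ℤ) * (2 * (J * h) + 3) := by positivity
    have h2 : ((k : ℤ) + 1) * (2 * (J * h) + 3) ≤ K * (2 * (J * h) + 3) :=
      mul_le_mul_of_nonneg_right (by omega) (by positivity)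
    have h3 : ((k : ℤ) + 1) * (2 * (J * h) + 3) =
      k * (2 * (J * h) + 3) + (2 * (J * h) + 3) := by ring
    refine hs.exists_isCrossing_of_gap hC (i := i) (lo := u i + k * (2 * (J * h) + 3))
      (hi := u i + (k + 1) * (2 * (J * h) + 3)) (by omega) (fun w hw hlw hwh => ?_)
      hu hv (by omega) (by omega) hT0 hTJ
    by_contra hne
    refine hgap w ?_ hlw hwh
    simp only [seeds, Finset.mem_filter]
    exact ⟨hw, Finset.not_nonempty_iff_eq_empty.1 hne⟩
  refine ⟨i, ?_⟩
  rcases le_total 0 (u i - v i) with h | h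
  · rw [abs_of_nonneg h] at hi
    exact key v hv u hu hi
  · rw [abs_of_nonpos h] at hi
    exact key u hu v hv (by omega)

end Deterministic

/-! ### Environments -/

/-- `X ω y m` are the times at which the site `y` may become occupied as soon as it has `m`
occupied neighbours; the numbers `q m` bound the rates at which these times occur, independently at
different sites. -/
structure IsEnvironment {Ω : Type*} [MeasurableSpace Ω] (P : Measure Ω) {n : ℕ}
    (X : Ω → Site n → ℕ → Set ℝ) (q : ℕ → ℝ) : Prop where
  mono : ∀ ω y, Monotone (X ω y)
  bound : ∀ m ≤ n, ∀ a b, ∀ S : Finset (Site n),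
    P {ω | ∀ y ∈ S, (X ω y m ∩ Set.Ioc a b).Nonempty} ≤ ENNReal.ofReal (q m * (b - a)) ^ S.card

/-- At least `h` sites of `F` may become occupied during `(a, b]` with `m` occupied neighbours. -/
def ManyHits {n : ℕ} (X : Site n → ℕ → Set ℝ) (m : ℕ) (a b : ℝ) (F : Finset (Site n))
    (h : ℕ) : Prop :=
  ∃ S ⊆ F, S.card = h ∧ ∀ y ∈ S, (X y m ∩ Set.Ioc a b).Nonempty

/-- Some connected subset of `F` of diameter larger than `l` may be filled from inside during
`(a, b]`. -/
def HasLarge {n : ℕ} (X : Site n → ℕ → Set ℝ) (F : Finset (Site n)) (a b l : ℝ) : Prop :=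
  ∃ C ⊆ F, ∃ t, IsLinked C ∧ IsSchedule X a b C t ∧ ∃ u ∈ C, ∃ v ∈ C, l < dist u v

/-- The sites whose coordinates differ from those of `x` by at most `r`. -/
noncomputable def cuboid {n : ℕ} (x : Site n) (r : Fin n → ℝ) : Finset (Site n) :=
  Fintype.piFinset fun j => Finset.Icc (x j - ⌊r j⌋) (x j + ⌊r j⌋)

/-- The times of the process obtained by merging the sites of each column of height `2 h + 1`
around the level `l` in the direction `i`, when one occupied neighbour is granted to all sites. -/
def columns {n : ℕ} (X : Site (n + 1) → ℕ → Set ℝ) (i : Fin (n + 1)) (l : ℤ) (h : ℕ) :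
    Site n → ℕ → Set ℝ :=
  fun y m => {r | ∃ w, i.removeNth w = y ∧ |w i - l| ≤ h ∧ r ∈ X w (m + 1)}

section Environment

variable {Ω : Type*} [MeasurableSpace Ω] {P : Measure Ω}

theorem measure_exists_mem_le {ι : Type*} (F : Finset ι) {p : ι → Ω → Prop} {c : ℝ≥0∞}
    (h : ∀ x ∈ F, P {ω | p x ω} ≤ c) : P {ω | ∃ x ∈ F, p x ω} ≤ F.card * c := by
  have : {ω | ∃ x ∈ F, p x ω} = ⋃ x ∈ F, {ω | p x ω} := by
    ext ω
    simp
  rw [this, ← nsmul_eq_mul]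
  exact (measure_biUnion_finset_le F _).trans (Finset.sum_le_card_nsmul _ _ _ h)

theorem mem_cuboid {n : ℕ} {x y : Site n} {r : Fin n → ℝ} :
    y ∈ cuboid x r ↔ ∀ j, |(y j : ℝ) - x j| ≤ r j := by
  simp only [cuboid, Fintype.mem_piFinset, Finset.mem_Icc]
  refine forall_congr' fun j => ?_
  have : |(y j : ℝ) - x j| ≤ r j ↔ |y j - x j| ≤ ⌊r j⌋ := by
    rw [Int.le_floor]
    push_cast
    rfl
  rw [this, abs_le]
  constructor <;> rintro ⟨h1, h2⟩ <;> constructor <;> omega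

theorem card_cuboid {n : ℕ} (x : Site n) {r : Fin n → ℝ} (hr : ∀ j, 0 ≤ r j) :
    ((cuboid x r).card : ℝ) ≤ ∏ j, (2 * r j + 1) := by
  rw [cuboid, Fintype.card_piFinset]
  push_cast
  refine Finset.prod_le_prod (fun _ _ => by positivity) fun j _ => ?_
  have h0 : 0 ≤ ⌊r j⌋ := Int.floor_nonneg.2 (hr j)
  rw [Int.card_Icc]
  have : ((x j + ⌊r j⌋ + 1 - (x j - ⌊r j⌋)).toNat : ℤ) = 2 * ⌊r j⌋ + 1 := by omega
  have : ((x j + ⌊r j⌋ + 1 - (x j - ⌊r j⌋)).toNat : ℝ) = 2 * ⌊r j⌋ + 1 := by exact_mod_cast this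
  rw [this]
  linarith [Int.floor_le (r j)]

variable {n : ℕ} {q q' : ℕ → ℝ}

theorem IsEnvironment.mono_rate {X : Ω → Site n → ℕ → Set ℝ} (hX : IsEnvironment P X q)
    (hq : ∀ m ≤ n, 0 ≤ q m) (hqq' : ∀ m ≤ n, q m ≤ q' m) : IsEnvironment P X q' where
  mono := hX.mono
  bound m hm a b S := by
    refine (hX.bound m hm a b S).trans (pow_le_pow_left' ?_ _)
    rcases le_total 0 (b - a) with h | h
    · exact ENNReal.ofReal_le_ofReal (mul_le_mul_of_nonneg_right (hqq' m hm) h)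
    · rw [ENNReal.ofReal_of_nonpos (mul_nonpos_of_nonneg_of_nonpos (hq m hm) h)]
      exact zero_le

/-- Union bound over the `h`-element subsets of `F`, at most `F.card ^ h` in number. -/
theorem IsEnvironment.measure_manyHits_le {X : Ω → Site n → ℕ → Set ℝ}
    (hX : IsEnvironment P X q) {m : ℕ} (hm : m ≤ n) (a b : ℝ) (F : Finset (Site n)) (h : ℕ) :
    P {ω | ManyHits (X ω) m a b F h} ≤ (F.card * ENNReal.ofReal (q m * (b - a))) ^ h := by
  have hset : {ω | ManyHits (X ω) m a b F h} =
      {ω | ∃ S ∈ F.powersetCard h, ∀ y ∈ S, (X ω y m ∩ Set.Ioc a b).Nonempty} := by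
    ext ω
    simp [ManyHits, Finset.mem_powersetCard, and_assoc]
  rw [hset]
  refine (measure_exists_mem_le (c := ENNReal.ofReal (q m * (b - a)) ^ h) _ fun S hS => ?_).trans ?_
  · rw [← (Finset.mem_powersetCard.1 hS).2]
    exact hX.bound m hm a b S
  · rw [Finset.card_powersetCard, mul_pow]
    gcongr
    exact_mod_cast Nat.choose_le_pow _ _

/-- A hit in each column means a hit at one chosen site of each column. The union bound over the
choices costs `2 h + 1` per column, which goes into the rate. -/
theorem IsEnvironment.columns {X : Ω → Site (n + 1) → ℕ → Set ℝ} (hX : IsEnvironment P X q)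
    (i : Fin (n + 1)) (l : ℤ) (h : ℕ) :
    IsEnvironment P (fun ω => columns (X ω) i l h) fun m => (2 * h + 1) * q (m + 1) where
  mono ω y m m' hm := by
    rintro r ⟨w, hw, hwl, hr⟩
    exact ⟨w, hw, hwl, hX.mono ω w (Nat.succ_le_succ hm) hr⟩
  bound m hm a b S := by
    classical
    set G : Finset (S → ℤ) := Fintype.piFinset fun _ => Finset.Icc (l - h) (l + h) with hG
    have hcard : G.card = (2 * h + 1) ^ S.card := by
      rw [hG, Fintype.card_piFinset]
      simp only [Int.card_Icc, Finset.prod_const, Finset.card_univ, Fintype.card_coe]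
      congr 1
      omega
    have hsub : {ω | ∀ y ∈ S, (NucleationGrowth.columns (X ω) i l h y m ∩ Set.Ioc a b).Nonempty} ⊆
        {ω | ∃ f ∈ G, ∀ w ∈ (Finset.univ : Finset S).image fun y => i.insertNth (f y) y.1,
          (X ω w (m + 1) ∩ Set.Ioc a b).Nonempty} := by
      intro ω hω
      have h1 : ∀ y : S, ∃ k ∈ Finset.Icc (l - h) (l + h),
          (X ω (i.insertNth k y.1) (m + 1) ∩ Set.Ioc a b).Nonempty := by
        intro y
        obtain ⟨r, ⟨w, hwy, hwl, hr⟩, hrab⟩ := hω y.1 y.2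
        have := abs_le.1 hwl
        refine ⟨w i, Finset.mem_Icc.2 ⟨by omega, by omega⟩, r, ?_, hrab⟩
        rwa [← hwy, Fin.insertNth_self_removeNth]
      choose f hf hf' using h1
      refine ⟨f, Fintype.mem_piFinset.2 hf, fun w hw => ?_⟩
      obtain ⟨y, _, rfl⟩ := Finset.mem_image.1 hw
      exact hf' y
    refine (measure_mono hsub).trans ((measure_exists_mem_le
      (c := ENNReal.ofReal (q (m + 1) * (b - a)) ^ S.card) _ fun f _ => ?_).trans ?_)
    · have hinj : Function.Injective fun y : S => (i.insertNth (f y) y.1 : Site (n + 1)) := by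
        intro y z hyz
        refine Subtype.ext ?_
        have := congrArg i.removeNth hyz
        simpa using this
      have := hX.bound (m + 1) (Nat.succ_le_succ hm) a b
        ((Finset.univ : Finset S).image fun y => i.insertNth (f y) y.1)
      rwa [Finset.card_image_of_injective _ hinj, Finset.card_univ, Fintype.card_coe] at this
    · have hmul : ENNReal.ofReal ((2 * h + 1) * q (m + 1) * (b - a)) =
          ((2 * h + 1 : ℕ) : ℝ≥0∞) * ENNReal.ofReal (q (m + 1) * (b - a)) := by
        rw [mul_assoc, ENNReal.ofReal_mul (by positivity), ← ENNReal.ofReal_natCast]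
        push_cast
        rfl
      rw [hcard, hmul, mul_pow, Nat.cast_pow]

end Environment

/-! ### Reduction of large sets to many hits -/

section Reduction

variable {n : ℕ} {X : Site (n + 1) → ℕ → Set ℝ} {a b : ℝ} {C F : Finset (Site (n + 1))}
  {t : Site (n + 1) → ℝ}

theorem mem_cuboid_of_dist_le {n : ℕ} {x y : Site n} {r : ℝ} (h : dist y x ≤ r) :
    y ∈ cuboid x fun _ => r := by
  refine mem_cuboid.2 fun j => ?_
  have := (dist_le_pi_dist y x j).trans h
  rw [Int.dist_eq] at this
  exact_mod_cast this

theorem ManyHits.of_le {n : ℕ} {X : Site n → ℕ → Set ℝ} {F F' : Finset (Site n)} {m m' h h' : ℕ}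
    (hF : ManyHits X m a b F h) (hX : ∀ y, Monotone (X y)) (hFF' : F ⊆ F') (hm : m ≤ m')
    (hh : h' ≤ h) : ManyHits X m' a b F' h' := by
  obtain ⟨S, hS, hcard, hhit⟩ := hF
  obtain ⟨S', hS', hcard'⟩ := Finset.exists_subset_card_eq (hcard ▸ hh)
  exact ⟨S', (hS'.trans hS).trans hFF', hcard', fun y hy =>
    (hhit y (hS' hy)).mono (Set.inter_subset_inter_left _ (hX y hm))⟩

theorem IsSchedule.manyHits_seeds {n : ℕ} {X : Site n → ℕ → Set ℝ} {C : Finset (Site n)}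
    {t : Site n → ℝ} (hs : IsSchedule X a b C t) :
    ManyHits X 0 a b C (seeds C t).card := by
  refine ⟨seeds C t, Finset.filter_subset _ _, rfl, fun y hy => ?_⟩
  obtain ⟨hyC, hye⟩ := Finset.mem_filter.1 hy
  have := hs.mem y hyC
  rw [hye, Finset.card_empty] at this
  exact ⟨t y, this, hs.time y hyC⟩

/-- The sites given by `exists_card_le_one` are in different layers, hence distinct. -/
theorem IsCrossing.manyHits {i : Fin (n + 1)} {s : ℤ} {h : ℕ} {a' b' : ℝ} {x : Site (n + 1)}
    (hc : IsCrossing C t i s h a b x) (hX : ∀ y, Monotone (X y)) (hs : IsSchedule X a' b' C t) :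
    ManyHits X 1 a b (component (slab C t i s h x) x) h := by
  classical
  have := fun k : Fin h => hc.exists_card_le_one hX hs k.2
  choose f hf hfi hft using this
  refine ⟨Finset.univ.image f, fun y hy => ?_, ?_, fun y hy => ?_⟩
  · obtain ⟨k, _, rfl⟩ := Finset.mem_image.1 hy
    exact hf k
  · rw [Finset.card_image_of_injective, Finset.card_fin]
    intro k k' hkk'
    have h1 := hfi k
    have h2 := hfi k'
    rw [hkk'] at h1
    exact Fin.ext (by omega)
  · obtain ⟨k, _, rfl⟩ := Finset.mem_image.1 hy
    exact ⟨t (f k), hft k, hc.time_mem (component_subset (hf k))⟩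

theorem HasLarge.manyHits_or_exists_isCrossing {n : ℕ} {X : Site n → ℕ → Set ℝ}
    {F : Finset (Site n)} (hX : ∀ y, Monotone (X y)) {l : ℝ} {J h K : ℕ}
    (hF : HasLarge X F a b l) (hl : (K : ℝ) * (2 * (J * h) + 3) ≤ l)
    {T : ℕ → ℝ} (hT0 : T 0 ≤ a) (hTJ : b ≤ T J) :
    (∃ x ∈ F, ManyHits X 0 a b (cuboid x fun _ => 2 * l + 2) K) ∨
    ∃ C ⊆ F, ∃ t, IsSchedule X a b C t ∧ (∀ u ∈ C, ∀ v ∈ C, dist u v ≤ 2 * l + 2) ∧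
      ∃ i, ∃ j < J, ∃ s x, IsCrossing C t i s h (T j) (T (j + 1)) x := by
  obtain ⟨C, hC, t, hlink, hs, u, hu, v, hv, huv⟩ := hF
  obtain ⟨D, hD, hDs, hDl, hDd, u', hu', v', hv', huv'⟩ :=
    hs.exists_intermediate (le_trans (by positivity) hl) hu (hlink u hu v hv) huv
  by_cases hK : K ≤ (seeds D t).card
  · exact .inl ⟨u', hC (hD hu'), hDs.manyHits_seeds.of_le hX
      (fun y hy => mem_cuboid_of_dist_le (hDd y hy u' hu')) le_rfl hK⟩
  · exact .inr ⟨D, hD.trans hC, t, hDs, hDd, hDs.exists_isCrossing hDl (not_le.1 hK) hu' hv'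
      (hl.trans_lt huv') hT0 hTJ⟩

theorem HasLarge.exists_manyHits (hX : ∀ y, Monotone (X y)) {l : ℝ} {h : ℕ}
    (hF : HasLarge X F a b l) (hl : (h : ℝ) * (2 * h + 3) ≤ l) :
    ∃ x ∈ F, ManyHits X 1 a b (cuboid x fun _ => 2 * l + 2) h := by
  -- A single time slot is enough here: seeds and crossings both produce hits with one neighbour.
  rcases hF.manyHits_or_exists_isCrossing hX (J := 1) (h := h) (K := h) (by simpa using hl)
    (T := fun j => if j = 0 then a else b) (by simp) (by simp) with
    ⟨x, hx, hm⟩ | ⟨C, hC, t, hs, hd, i, j, hj, s, x, hc⟩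
  · exact ⟨x, hx, hm.of_le hX subset_rfl zero_le_one le_rfl⟩
  · obtain rfl : j = 0 := by omega
    simp only [if_true, zero_add, one_ne_zero, if_false] at hc
    exact ⟨x, hC hc.mem, (hc.manyHits hX hs).of_le hX (fun y hy => mem_cuboid_of_dist_le
      (hd y (mem_slab.1 (component_subset hy)).1 x hc.mem)) le_rfl le_rfl⟩

/-- Either the projection of the crossing is large, which is an event in one dimension less, or the
one-neighbour hits of the crossing are confined to a cuboid of height of order `h` and base of
radius `r`. -/
theorem HasLarge.exists_manyHits_or_hasLarge_columns [DecidableEq (Site n)]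
    (hX : ∀ y, Monotone (X y)) {l r : ℝ}
    {J h : ℕ} (hF : HasLarge X F a b l) (hl : (h : ℝ) * (2 * (J * h) + 3) ≤ l)
    {T : ℕ → ℝ} (hT0 : T 0 ≤ a) (hTJ : b ≤ T J) :
    (∃ x ∈ F, ManyHits X 0 a b (cuboid x fun _ => 2 * l + 2) h) ∨
    ∃ x ∈ F, ∃ i ∈ (Finset.univ : Finset (Fin (n + 1))), ∃ j ∈ Finset.range J,
      HasLarge (columns X i (x i) h) (F.image i.removeNth) (T j) (T (j + 1)) r ∨
      ManyHits X 1 (T j) (T (j + 1)) (cuboid x (i.insertNth (h : ℝ) fun _ => r)) h := by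
  rcases hF.manyHits_or_exists_isCrossing hX hl hT0 hTJ with
    hm | ⟨C, hC, t, hs, hd, i, j, hj, s, x, hc⟩
  · exact .inl hm
  refine .inr ⟨x, hC hc.mem, i, Finset.mem_univ _, j, Finset.mem_range.2 hj, ?_⟩
  by_cases hlarge : HasLarge (columns X i (x i) h) (F.image i.removeNth) (T j) (T (j + 1)) r
  · exact .inl hlarge
  refine .inr ((hc.manyHits hX hs).of_le hX (fun y hy => ?_) le_rfl le_rfl)
  obtain ⟨t', ht'⟩ := hc.exists_isSchedule_image hX hs
  have hslab := hc.le_of_mem_slab (component_subset hy)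
  have hdist : dist (i.removeNth y) (i.removeNth x) ≤ r := by
    by_contra! hcon
    refine hlarge ⟨_, Finset.image_subset_image fun z hz =>
      hC (mem_slab.1 (component_subset hz)).1, t', isLinked_component.image_removeNth i, ht',
      _, Finset.mem_image_of_mem _ hy, _, Finset.mem_image_of_mem _
      (mem_component_self hc.mem_slab_self), hcon⟩
  refine mem_cuboid.2 fun k => ?_
  rcases Fin.eq_self_or_eq_succAbove i k with rfl | ⟨k, rfl⟩
  · rw [Fin.insertNth_apply_same]
    have : |y k - x k| ≤ h := by
      rw [abs_le]
      rcases hc.sign with rfl | rfl <;> constructor <;> omega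
    exact_mod_cast this
  · rw [Fin.insertNth_apply_succAbove]
    exact mem_cuboid.1 (mem_cuboid_of_dist_le hdist) k

end Reduction

/-! ### Large sets are super-exponentially unlikely -/

/-- Before the time `exp (β κ)`, where `κ < κ_n`, sets of diameter larger than
`exp (β (Γ_n - κ_n) / n)` are filled from inside with super-exponentially small probability,
uniformly over the environments with the given rates. -/
def LargeUnlikely {Ω : Type*} [MeasurableSpace Ω] (P : Measure Ω) (n : ℕ) : Prop :=
  ∀ Γ : ℕ → ℝ, (∀ k < n, Γ k ≤ Γ (k + 1)) → ∀ κ < kappa Γ n,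
    ∃ ε > 0, ∃ lam ≥ 0, n * lam ≤ Γ n - kappa Γ n ∧ (lam = 0 ∨ n * lam < Γ n - kappa Γ n) ∧
    ∀ A L : ℝ, ∃ M ≥ 1, ∀ᶠ β : ℝ in atTop, ∀ X : Ω → Site n → ℕ → Set ℝ,
      IsEnvironment P X (fun m => Real.exp (-(β * (Γ (n - m) - ε)))) →
      ∀ F : Finset (Site n), (F.card : ℝ) ≤ Real.exp (β * L) →
      ∀ a b, b - a ≤ Real.exp (β * κ) →
        P {ω | HasLarge (X ω) F a b (M * Real.exp (β * lam))} ≤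
          ENNReal.ofReal (Real.exp (-(β * A)))

/-- Both terms of the maximum qualify, the second being a weighted mean of `Γ n` and `kappa Γ (n -
1)`. -/
theorem kappa_le {Γ : ℕ → ℝ} {n : ℕ} (h : ∀ k < n, Γ k ≤ Γ (k + 1)) : kappa Γ n ≤ Γ n := by
  induction n with
  | zero => exact le_rfl
  | succ n ih =>
    have h1 := ih fun k hk => h k (by omega)
    have h2 := h n (by omega)
    refine max_le h2 ((div_le_iff₀ (by positivity)).2 ?_)
    have : ((n : ℝ) + 1) * kappa Γ n ≤ (n + 1) * Γ (n + 1) :=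
      mul_le_mul_of_nonneg_left (h1.trans h2) (by positivity)
    linarith

theorem eventually_le_exp (c : ℝ) {θ : ℝ} (hθ : 0 < θ) : ∀ᶠ β : ℝ in atTop, c ≤ Real.exp (β * θ) :=
  (Real.tendsto_exp_atTop.comp (tendsto_id.atTop_mul_const hθ)).eventually_ge_atTop c

section Induction

variable {Ω : Type*} [MeasurableSpace Ω] {P : Measure Ω} {n : ℕ} {q : ℕ → ℝ}

/-- The bound on the probability of many hits, in exponential form. -/
theorem IsEnvironment.measure_manyHits_le_exp {X : Ω → Site n → ℕ → Set ℝ}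
    (hX : IsEnvironment P X q) {m : ℕ} (hm : m ≤ n) {a b v p β θ A : ℝ} (F : Finset (Site n))
    {h : ℕ} (hF : (F.card : ℝ) ≤ v) (hp : 0 ≤ p) (hq : q m * (b - a) ≤ p)
    (hv : v * p ≤ Real.exp (-(β * θ))) (hβ : 0 ≤ β) (hh : A ≤ h * θ) :
    P {ω | ManyHits (X ω) m a b F h} ≤ ENNReal.ofReal (Real.exp (-(β * A))) := by
  refine (hX.measure_manyHits_le hm a b F h).trans ?_
  have h1 : (F.card : ℝ≥0∞) * ENNReal.ofReal (q m * (b - a)) ≤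
      ENNReal.ofReal (Real.exp (-(β * θ))) := by
    rw [← ENNReal.ofReal_natCast, ← ENNReal.ofReal_mul (by positivity)]
    exact ENNReal.ofReal_le_ofReal ((mul_le_mul_of_nonneg_left hq (by positivity)).trans
      ((mul_le_mul_of_nonneg_right hF hp).trans hv))
  refine (pow_le_pow_left' h1 h).trans ?_
  rw [← ENNReal.ofReal_pow (Real.exp_pos _).le, ← Real.exp_nat_mul]
  refine ENNReal.ofReal_le_ofReal (Real.exp_le_exp.2 ?_)
  have := mul_le_mul_of_nonneg_left hh hβ
  linarith

theorem measure_exists_mem_le_ofReal {ι : Type*} (F : Finset ι) {p : ι → Ω → Prop} {c v : ℝ}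
    (hv : (F.card : ℝ) ≤ v) (hc : 0 ≤ c) (h : ∀ x ∈ F, P {ω | p x ω} ≤ ENNReal.ofReal c) :
    P {ω | ∃ x ∈ F, p x ω} ≤ ENNReal.ofReal (v * c) := by
  refine (measure_exists_mem_le F h).trans ?_
  rw [← ENNReal.ofReal_natCast, ← ENNReal.ofReal_mul (by positivity)]
  exact ENNReal.ofReal_le_ofReal (mul_le_mul_of_nonneg_right hv hc)

theorem measure_or_le_ofReal {p p' : Ω → Prop} {c c' : ℝ} (hc : 0 ≤ c) (hc' : 0 ≤ c')
    (h : P {ω | p ω} ≤ ENNReal.ofReal c) (h' : P {ω | p' ω} ≤ ENNReal.ofReal c') :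
    P {ω | p ω ∨ p' ω} ≤ ENNReal.ofReal (c + c') := by
  rw [ENNReal.ofReal_add hc hc']
  exact (measure_union_le {ω | p ω} {ω | p' ω}).trans (add_le_add h h')

theorem card_cuboid_const {x : Site n} {r : ℝ} (hr : 1 ≤ r) :
    ((cuboid x fun _ => r).card : ℝ) ≤ (3 * r) ^ n := by
  refine (card_cuboid x fun _ => by linarith).trans ?_
  rw [Finset.prod_const, Finset.card_univ, Fintype.card_fin]
  exact pow_le_pow_left₀ (by linarith) (by linarith) n

theorem card_cuboid_insertNth {x : Site (n + 1)} {i : Fin (n + 1)} {h : ℕ} {r : ℝ} (hr : 1 ≤ r) :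
    ((cuboid x (i.insertNth (h : ℝ) fun _ => r)).card : ℝ) ≤ (2 * h + 1) * (3 * r) ^ n := by
  have h0 : ∀ j, 0 ≤ (i.insertNth (h : ℝ) (fun _ => r) : Fin (n + 1) → ℝ) j := by
    intro j
    rcases Fin.eq_self_or_eq_succAbove i j with rfl | ⟨j, rfl⟩
    · rw [Fin.insertNth_apply_same]
      positivity
    · rw [Fin.insertNth_apply_succAbove]
      linarith
  refine (card_cuboid x h0).trans ?_
  rw [Fin.prod_univ_succAbove _ i, Fin.insertNth_apply_same]
  simp only [Fin.insertNth_apply_succAbove, Finset.prod_const, Finset.card_univ, Fintype.card_fin]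
  exact mul_le_mul_of_nonneg_left (pow_le_pow_left₀ (by linarith) (by linarith) n) (by positivity)

theorem largeUnlikely_zero (P : Measure Ω) : LargeUnlikely P 0 := by
  intro Γ _ κ _
  refine ⟨1, one_pos, 0, le_rfl, by simp [kappa], .inl rfl, fun A L => ⟨1, le_rfl, ?_⟩⟩
  refine Eventually.of_forall fun β X _ F _ a b _ => ?_
  have : {ω | HasLarge (X ω) F a b (1 * Real.exp (β * 0))} = ∅ := by
    ext ω
    simp only [Set.mem_ofPred_eq, Set.mem_empty_iff_false, iff_false]
    rintro ⟨C, _, t, _, _, u, _, v, _, huv⟩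
    rw [Subsingleton.elim u v, dist_self] at huv
    exact absurd huv (not_lt.2 (by positivity))
  rw [this, measure_empty]
  exact zero_le

/-- Before the faces of a finite cuboid start to grow, the filled sets remain bounded. -/
theorem largeUnlikely_of_lt {Γ : ℕ → ℝ} {κ : ℝ} (hκ : κ < Γ n) (A L : ℝ) : ∃ M ≥ 1,
    ∀ᶠ β : ℝ in atTop, ∀ X : Ω → Site (n + 1) → ℕ → Set ℝ,
      IsEnvironment P X (fun m => Real.exp (-(β * (Γ (n + 1 - m) - (Γ n - κ) / 2)))) →
      ∀ F : Finset (Site (n + 1)), (F.card : ℝ) ≤ Real.exp (β * L) →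
      ∀ a b, b - a ≤ Real.exp (β * κ) →
        P {ω | HasLarge (X ω) F a b M} ≤ ENNReal.ofReal (Real.exp (-(β * A))) := by
  set ε := (Γ n - κ) / 2 with hε
  have hε0 : 0 < ε := by linarith
  -- Each hit costs `exp (-β ε / 2)` once the bounded volume is absorbed; `L` pays for the choice of
  -- the centre in `F`.
  obtain ⟨h, hh⟩ := exists_nat_ge ((A + L) / (ε / 2))
  rw [div_le_iff₀ (by positivity)] at hh
  set M : ℝ := h * (2 * h + 3) + 1 with hM
  have hM1 : 1 ≤ M := by rw [hM]; nlinarith [Nat.cast_nonneg (α := ℝ) h]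
  refine ⟨M, hM1, ?_⟩
  filter_upwards [eventually_ge_atTop 0,
    eventually_le_exp ((3 * (2 * M + 2)) ^ (n + 1)) (half_pos hε0)] with β hβ hc X hX F hF a b hab
  have hsub : {ω | HasLarge (X ω) F a b M} ⊆
      {ω | ∃ x ∈ F, ManyHits (X ω) 1 a b (cuboid x fun _ => 2 * M + 2) h} :=
    fun ω hω => hω.exists_manyHits (hX.mono ω) (by linarith)
  refine (measure_mono hsub).trans ((measure_exists_mem_le_ofReal F
    (c := Real.exp (-(β * (A + L)))) hF (Real.exp_pos _).le fun x _ =>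
    hX.measure_manyHits_le_exp (by omega) _ (card_cuboid_const (by linarith))
      (p := Real.exp (-(β * ε))) (Real.exp_pos _).le ?_ ?_ hβ hh).trans (le_of_eq ?_))
  · refine (mul_le_mul_of_nonneg_left hab (Real.exp_pos _).le).trans (le_of_eq ?_)
    rw [← Real.exp_add, Nat.add_sub_cancel, hε]
    ring_nf
  · refine (mul_le_mul_of_nonneg_right hc (Real.exp_pos _).le).trans (le_of_eq ?_)
    rw [← Real.exp_add]
    ring_nf
  · rw [← Real.exp_add]
    ring_nf

/-- The final union bound: `L` pays for the centre, `lam` for the time slot, and `1` for the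
constant `4 n + 5`. -/
theorem exp_sum_le {β A L lam : ℝ} (hβ : 0 ≤ β) (hlam : 0 ≤ lam)
    (hn : (4 * n + 5 : ℝ) ≤ Real.exp (β * 1)) :
    Real.exp (β * L) * Real.exp (-(β * (A + L + lam + 1))) + Real.exp (β * L) * ((n + 1) *
      (2 * Real.exp (β * lam) * (Real.exp (-(β * (A + L + lam + 1))) +
        Real.exp (-(β * (A + L + lam + 1)))))) ≤ Real.exp (-(β * A)) := by
  have h1 : Real.exp (β * L) * Real.exp (-(β * (A + L + lam + 1))) =
      Real.exp (-(β * (A + 1))) * Real.exp (-(β * lam)) := by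
    simp only [← Real.exp_add]
    ring_nf
  have h2 : Real.exp (-(β * lam)) * Real.exp (β * lam) = 1 := by
    rw [← Real.exp_add]
    simp
  have h3 : Real.exp (-(β * (A + 1))) * Real.exp (β * 1) = Real.exp (-(β * A)) := by
    rw [← Real.exp_add]
    ring_nf
  have h4 : Real.exp (-(β * lam)) ≤ 1 := by
    rw [Real.exp_le_one_iff]
    exact neg_nonpos.2 (mul_nonneg hβ hlam)
  have h5 := (Real.exp_pos (-(β * (A + 1)))).le
  calc _ = Real.exp (β * L) * Real.exp (-(β * (A + L + lam + 1))) *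
        (1 + 4 * (n + 1) * Real.exp (β * lam)) := by ring
    _ = Real.exp (-(β * (A + 1))) *
        (Real.exp (-(β * lam)) + 4 * (n + 1) * (Real.exp (-(β * lam)) * Real.exp (β * lam))) := by
      rw [h1]
      ring
    _ ≤ Real.exp (-(β * (A + 1))) * Real.exp (β * 1) := by
      rw [h2]
      exact mul_le_mul_of_nonneg_left (by linarith) h5
    _ = _ := h3

/-- When the faces grow, the speed of their growth is controlled by the process in one dimension
less. -/
theorem largeUnlikely_of_le (ih : LargeUnlikely P n) {Γ : ℕ → ℝ}
    (hΓ : ∀ k < n, Γ k ≤ Γ (k + 1)) {κ lam : ℝ} (hlam : 0 ≤ lam) (hκlam : κ - lam < kappa Γ n)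
    (hκ : (n + 1) * lam + κ < Γ (n + 1)) : ∃ ε > 0, ∀ A L : ℝ, ∃ M ≥ 1,
    ∀ᶠ β : ℝ in atTop, ∀ X : Ω → Site (n + 1) → ℕ → Set ℝ,
      IsEnvironment P X (fun m => Real.exp (-(β * (Γ (n + 1 - m) - ε)))) →
      ∀ F : Finset (Site (n + 1)), (F.card : ℝ) ≤ Real.exp (β * L) →
      ∀ a b, b - a ≤ Real.exp (β * κ) →
        P {ω | HasLarge (X ω) F a b (M * Real.exp (β * lam))} ≤
          ENNReal.ofReal (Real.exp (-(β * A))) := by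
  classical
  obtain ⟨ε₁, hε₁, lam₁, hlam₁, hnlam₁, -, H⟩ := ih Γ hΓ (κ - lam) hκlam
  -- `η` is the exponential cost of one seed and `θ` that of one hit in a crossing, before the
  -- losses due to `ε` and to constants; a quarter of each survives these losses.
  set η := Γ (n + 1) - κ - (n + 1) * lam with hη
  set θ := kappa Γ n - (κ - lam) with hθ
  have hη0 : 0 < η := by linarith
  have hθ0 : 0 < θ := by linarith
  obtain ⟨ε, hε, hεε₁, hεη, hεθ⟩ : ∃ ε > 0, ε ≤ ε₁ / 2 ∧ ε ≤ η / 2 ∧ ε ≤ θ / 2 :=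
    ⟨min (ε₁ / 2) (min (η / 2) (θ / 2)), by positivity, min_le_left _ _,
      (min_le_right _ _).trans (min_le_left _ _), (min_le_right _ _).trans (min_le_right _ _)⟩
  refine ⟨ε, hε, fun A L => ?_⟩
  set A' := A + L + lam + 1 with hA'
  obtain ⟨h, hh⟩ := exists_nat_ge (max (A' / (η / 4)) (A' / (θ / 4)))
  have hhη := (le_max_left _ _).trans hh
  have hhθ := (le_max_right _ _).trans hh
  rw [div_le_iff₀ (by positivity)] at hhη hhθ
  obtain ⟨M₁, hM₁, hβ₁⟩ := H A' L
  set M : ℝ := h * (4 * h + 3) + 1 with hM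
  have hM1 : 1 ≤ M := by rw [hM]; nlinarith [Nat.cast_nonneg (α := ℝ) h]
  refine ⟨M, hM1, ?_⟩
  filter_upwards [hβ₁, eventually_ge_atTop 0, eventually_le_exp (2 * h + 1) (half_pos hε₁),
    eventually_le_exp ((12 * M) ^ (n + 1)) (show 0 < η / 4 by positivity),
    eventually_le_exp ((2 * h + 1) * (3 * M₁) ^ n) (show 0 < θ / 4 by positivity),
    eventually_le_exp (4 * n + 5) one_pos] with β hβ₁ hβ hβε hβη hβθ hβn X hX F hF a b hab
  set l := M * Real.exp (β * lam) with hl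
  set r := M₁ * Real.exp (β * lam₁) with hr
  have hexp1 : 1 ≤ Real.exp (β * lam) := Real.one_le_exp (mul_nonneg hβ hlam)
  have hexp2 : 1 ≤ Real.exp (β * lam₁) := Real.one_le_exp (mul_nonneg hβ hlam₁)
  have hl1 : 1 ≤ l := one_le_mul_of_one_le_of_one_le hM1 hexp1
  have hr1 : 1 ≤ r := one_le_mul_of_one_le_of_one_le hM₁ hexp2
  -- With this many slots, each lasts at most `exp (β (κ - lam))`, which is subcritical in dimension
  -- `n`.
  set J := ⌈Real.exp (β * lam)⌉₊ with hJ
  have hJge : Real.exp (β * lam) ≤ J := Nat.le_ceil _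
  have hJle : (J : ℝ) ≤ 2 * Real.exp (β * lam) := by
    have := (Nat.ceil_lt_add_one (Real.exp_pos (β * lam)).le).le
    linarith
  have hJ0 : (0 : ℝ) < J := (Real.exp_pos _).trans_le hJge
  set δ := (b - a) / J with hδ
  have hδle : δ ≤ Real.exp (β * (κ - lam)) := by
    rw [hδ, div_le_iff₀ hJ0, mul_sub, Real.exp_sub]
    refine hab.trans ?_
    rw [div_mul_eq_mul_div, le_div_iff₀ (Real.exp_pos _)]
    exact mul_le_mul_of_nonneg_left hJge (Real.exp_pos _).le
  set T : ℕ → ℝ := fun j => a + j * δ with hT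
  have hTsub : ∀ j, T (j + 1) - T j = δ := by
    intro j
    simp only [hT]
    push_cast
    ring
  have hTJ : b ≤ T J := by
    simp only [hT, hδ]
    rw [mul_div_cancel₀ _ hJ0.ne']
    linarith
  have hhl : (h : ℝ) * (2 * (J * h) + 3) ≤ l := by
    have h1 : 2 * ((J : ℝ) * h) + 3 ≤ (4 * h + 3) * Real.exp (β * lam) := by
      nlinarith [mul_le_mul_of_nonneg_right hJle (Nat.cast_nonneg (α := ℝ) h)]
    have h2 := mul_le_mul_of_nonneg_left h1 (Nat.cast_nonneg (α := ℝ) h)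
    have h3 : l = h * ((4 * h + 3) * Real.exp (β * lam)) + Real.exp (β * lam) := by
      rw [hl, hM]
      ring
    linarith [Real.exp_pos (β * lam)]
  have hsub : {ω | HasLarge (X ω) F a b l} ⊆ {ω |
      (∃ x ∈ F, ManyHits (X ω) 0 a b (cuboid x fun _ => 2 * l + 2) h) ∨
      ∃ x ∈ F, ∃ i ∈ (Finset.univ : Finset (Fin (n + 1))), ∃ j ∈ Finset.range J,
        HasLarge (columns (X ω) i (x i) h) (F.image i.removeNth) (T j) (T (j + 1)) r ∨
        ManyHits (X ω) 1 (T j) (T (j + 1)) (cuboid x (i.insertNth (h : ℝ) fun _ => r)) h} :=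
    fun ω hω => hω.exists_manyHits_or_hasLarge_columns (hX.mono ω) hhl (by simp [hT]) hTJ
  have hseeds : ∀ x ∈ F, P {ω | ManyHits (X ω) 0 a b (cuboid x fun _ => 2 * l + 2) h} ≤
      ENNReal.ofReal (Real.exp (-(β * A'))) := by
    intro x _
    refine hX.measure_manyHits_le_exp (by omega) _ (v := (12 * l) ^ (n + 1))
      ((card_cuboid_const (by linarith)).trans ?_)
      (p := Real.exp (-(β * (Γ (n + 1) - ε - κ)))) (Real.exp_pos _).le ?_ ?_ hβ hhη
    · exact pow_le_pow_left₀ (by linarith) (by linarith) _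
    · refine (mul_le_mul_of_nonneg_left hab (Real.exp_pos _).le).trans (le_of_eq ?_)
      rw [← Real.exp_add]
      simp only [Nat.sub_zero]
      ring_nf
    · rw [hl, ← mul_assoc, mul_pow, ← Real.exp_nat_mul, mul_assoc, ← Real.exp_add]
      refine (mul_le_mul_of_nonneg_right hβη (Real.exp_pos _).le).trans ?_
      rw [← Real.exp_add, Real.exp_le_exp]
      push_cast
      have := mul_le_mul_of_nonneg_left hεη hβ
      rw [hη] at this ⊢
      linarith
  have hhits : ∀ x ∈ F, ∀ i ∈ (Finset.univ : Finset (Fin (n + 1))), ∀ j ∈ Finset.range J,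
      P {ω | ManyHits (X ω) 1 (T j) (T (j + 1)) (cuboid x (i.insertNth (h : ℝ) fun _ => r)) h} ≤
      ENNReal.ofReal (Real.exp (-(β * A'))) := by
    intro x _ i _ j _
    refine hX.measure_manyHits_le_exp (by omega) _ (card_cuboid_insertNth hr1)
      (p := Real.exp (-(β * (Γ n - ε - (κ - lam))))) (Real.exp_pos _).le ?_ ?_ hβ hhθ
    · rw [hTsub]
      refine (mul_le_mul_of_nonneg_left hδle (Real.exp_pos _).le).trans (le_of_eq ?_)
      rw [← Real.exp_add, Nat.add_sub_cancel]
      ring_nf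
    · rw [hr, ← mul_assoc, mul_pow, ← Real.exp_nat_mul, ← mul_assoc, mul_assoc _ _ (Real.exp _),
        ← Real.exp_add]
      refine (mul_le_mul_of_nonneg_right hβθ (Real.exp_pos _).le).trans ?_
      rw [← Real.exp_add, Real.exp_le_exp]
      have h1 := mul_le_mul_of_nonneg_left hεθ hβ
      have h2 := mul_le_mul_of_nonneg_left hnlam₁ hβ
      rw [hθ] at h1 ⊢
      linarith
  have hcolumns : ∀ x ∈ F, ∀ i ∈ (Finset.univ : Finset (Fin (n + 1))), ∀ j ∈ Finset.range J,
      P {ω | HasLarge (columns (X ω) i (x i) h) (F.image i.removeNth) (T j) (T (j + 1)) r} ≤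
      ENNReal.ofReal (Real.exp (-(β * A'))) := by
    intro x _ i _ j _
    -- The factor `2 h + 1` is absorbed by the gap between `ε` and `ε₁`; this is why the induction
    -- hypothesis must tolerate an error in the energies.
    refine hβ₁ _ ((hX.columns i (x i) h).mono_rate (fun _ _ => by positivity) fun m _ => ?_) _
      (le_trans (by exact_mod_cast Finset.card_image_le) hF) _ _ ((hTsub j).trans_le hδle)
    refine (mul_le_mul_of_nonneg_right hβε (Real.exp_pos _).le).trans ?_
    rw [← Real.exp_add, Real.exp_le_exp, Nat.add_sub_add_right]
    have := mul_le_mul_of_nonneg_left hεε₁ hβ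
    linarith
  have hpos := (Real.exp_pos (-(β * A'))).le
  refine (measure_mono hsub).trans ((measure_or_le_ofReal
    (mul_nonneg (Real.exp_pos (β * L)).le hpos) ?_
    (measure_exists_mem_le_ofReal F hF hpos hseeds)
    (measure_exists_mem_le_ofReal F hF ?_ fun x hx =>
      measure_exists_mem_le_ofReal _ (v := n + 1) (by simp) ?_ fun i hi =>
        measure_exists_mem_le_ofReal _ (v := 2 * Real.exp (β * lam)) (by simpa using hJle) ?_
          fun j hj => measure_or_le_ofReal hpos hpos (hcolumns x hx i hi j hj)
            (hhits x hx i hi j hj))).trans (ENNReal.ofReal_le_ofReal ?_))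
  · positivity
  · positivity
  · positivity
  · positivity
  · exact exp_sum_le hβ hlam hβn

theorem largeUnlikely (P : Measure Ω) (n : ℕ) : LargeUnlikely P n := by
  induction n with
  | zero => exact largeUnlikely_zero P
  | succ n ih =>
    intro Γ hΓ κ hκ
    have hΓ' : ∀ k < n, Γ k ≤ Γ (k + 1) := fun k hk => hΓ k (by omega)
    rcases lt_or_ge κ (Γ n) with hlt | hge
    · refine ⟨(Γ n - κ) / 2, by linarith, 0, le_rfl, ?_, .inl rfl, fun A L => ?_⟩
      · linarith [kappa_le hΓ]
      · simpa using largeUnlikely_of_lt (P := P) hlt A L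
    -- As `Γ n ≤ κ < kappa Γ (n + 1)`, the maximum is its second term. Then `Γ (n + 1) - kappa Γ (n
    -- + 1)` equals `(n + 1) (kappa Γ (n + 1) - kappa Γ n)`, and `lam` is the midpoint of the
    -- interval from `κ - kappa Γ n` to `kappa Γ (n + 1) - kappa Γ n`.
    · have hk : kappa Γ (n + 1) = (Γ (n + 1) + (n + 1) * kappa Γ n) / (n + 2) := by
        refine max_eq_right (le_of_lt ?_)
        rcases lt_max_iff.1 (show κ < max _ _ from hκ) with h | h <;> linarith
      rw [eq_div_iff (by positivity)] at hk
      have hkn := (kappa_le hΓ').trans hge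
      have hlt : ((n : ℝ) + 1) * (κ - kappa Γ n + (kappa Γ (n + 1) - κ) / 2) <
          Γ (n + 1) - kappa Γ (n + 1) := by
        have : (0 : ℝ) < (n + 1) * ((kappa Γ (n + 1) - κ) / 2) := by
          have := sub_pos.2 hκ
          positivity
        nlinarith
      obtain ⟨ε, hε, H⟩ := largeUnlikely_of_le ih hΓ' (κ := κ)
        (lam := κ - kappa Γ n + (kappa Γ (n + 1) - κ) / 2) (by linarith) (by linarith) (by linarith)
      push_cast
      exact ⟨ε, hε, _, by linarith, hlt.le, .inr hlt, H⟩

end Induction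

/-! ### The Poisson arrivals -/

theorem expMeasure_eq_withDensity :
    expMeasure 1 = volume.withDensity (exponentialPDF 1) := rfl

theorem measurable_exponentialPDF : Measurable (exponentialPDF 1) :=
  (measurable_exponentialPDFReal 1).ennreal_ofReal

theorem exponentialPDF_add_lintegral (z : ℝ) :
    exponentialPDF 1 z + ∫⁻ y in Set.Iic z, exponentialPDF 1 y =
      (Set.Ici (0 : ℝ)).indicator 1 z := by
  rw [lintegral_exponentialPDF_eq_antiDeriv one_pos]
  by_cases hz : 0 ≤ z
  · rw [exponentialPDF_of_nonneg hz, if_pos hz, Set.indicator_of_mem (Set.mem_Ici.2 hz),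
      ← ENNReal.ofReal_add (by positivity)]
    · simp
    · rw [sub_nonneg, Real.exp_le_one_iff]
      linarith
  · rw [exponentialPDF_of_neg (not_le.1 hz), if_neg hz, Set.indicator_of_notMem (by simpa using hz)]
    simp

/-- The renewal equation for the intensity of a Poisson process. -/
theorem expMeasure_add_conv :
    expMeasure 1 + (volume.restrict (Set.Ici 0)) ∗ expMeasure 1 =
      volume.restrict (Set.Ici (0 : ℝ)) := by
  have := isProbabilityMeasure_expMeasure one_pos
  ext B hB
  have hmeas := measurable_exponentialPDF
  have hind : Measurable (B.indicator (1 : ℝ → ℝ≥0∞)) := measurable_one.indicator hB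
  have hind0 : Measurable ((Set.Ici (0 : ℝ)).indicator (1 : ℝ → ℝ≥0∞)) :=
    measurable_one.indicator measurableSet_Ici
  have h1 : expMeasure 1 B = ∫⁻ z, B.indicator 1 z * exponentialPDF 1 z := by
    rw [expMeasure_eq_withDensity, withDensity_apply _ hB, ← lintegral_indicator hB]
    refine lintegral_congr fun z => ?_
    by_cases hz : z ∈ B <;> simp [hz]
  have h2 : ((volume.restrict (Set.Ici 0)) ∗ expMeasure 1) B =
      ∫⁻ z, B.indicator 1 z * ∫⁻ y in Set.Iic z, exponentialPDF 1 y := by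
    calc ((volume.restrict (Set.Ici 0)) ∗ expMeasure 1) B
        = ∫⁻ z, B.indicator 1 z ∂((volume.restrict (Set.Ici (0 : ℝ))) ∗ expMeasure 1) := by
          rw [lintegral_indicator_one hB]
      _ = ∫⁻ x in Set.Ici (0 : ℝ), ∫⁻ y, B.indicator 1 (x + y) ∂(expMeasure 1) :=
          Measure.lintegral_conv hind
      _ = ∫⁻ x, ∫⁻ z, (Set.Ici (0 : ℝ)).indicator 1 x *
            (exponentialPDF 1 (z - x) * B.indicator 1 z) := by
          rw [← lintegral_indicator measurableSet_Ici]
          refine lintegral_congr fun x => ?_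
          rw [lintegral_const_mul _ (by fun_prop)]
          by_cases hx : x ∈ Set.Ici (0 : ℝ)
          · rw [Set.indicator_of_mem hx, Set.indicator_of_mem hx, Pi.one_apply, one_mul,
              expMeasure_eq_withDensity, lintegral_withDensity_eq_lintegral_mul _ hmeas
                (show Measurable fun y => B.indicator 1 (x + y) from
                  hind.comp (measurable_const_add x)),
              ← lintegral_add_left_eq_self (fun z => exponentialPDF 1 (z - x) * B.indicator 1 z) x]
            simp
          · rw [Set.indicator_of_notMem hx, Set.indicator_of_notMem hx, zero_mul]
      _ = ∫⁻ z, ∫⁻ x, (Set.Ici (0 : ℝ)).indicator 1 x *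
            (exponentialPDF 1 (z - x) * B.indicator 1 z) := by
          refine lintegral_lintegral_swap (Measurable.aemeasurable ?_)
          exact (hind0.comp measurable_fst).mul
            ((hmeas.comp (measurable_snd.sub measurable_fst)).mul (hind.comp measurable_snd))
      _ = _ := by
          refine lintegral_congr fun z => ?_
          have : ∀ x, (Set.Ici (0 : ℝ)).indicator 1 x *
              (exponentialPDF 1 (z - x) * B.indicator 1 z) =
              B.indicator 1 z * ((Set.Iic z).indicator (exponentialPDF 1) (z - x)) := by
            intro x
            by_cases hx : 0 ≤ x
            · have hx' : z - x ∈ Set.Iic z := by simpa using hx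
              rw [Set.indicator_of_mem (Set.mem_Ici.2 hx), Set.indicator_of_mem hx', Pi.one_apply,
                one_mul, mul_comm]
            · have hx' : z - x ∉ Set.Iic z := by simpa using hx
              rw [Set.indicator_of_notMem (show x ∉ Set.Ici 0 from hx),
                Set.indicator_of_notMem hx', zero_mul, mul_zero]
          simp_rw [this]
          rw [lintegral_const_mul _ (show Measurable fun x =>
            (Set.Iic z).indicator (exponentialPDF 1) (z - x) from
              (hmeas.indicator measurableSet_Iic).comp (measurable_const.sub measurable_id)),
            lintegral_sub_left_eq_self,
            lintegral_indicator measurableSet_Iic]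
  rw [Measure.add_apply, h1, h2, ← lintegral_add_left (show Measurable fun z =>
    B.indicator 1 z * exponentialPDF 1 z from hind.mul hmeas)]
  simp_rw [← mul_add, exponentialPDF_add_lintegral]
  rw [Measure.restrict_apply hB, ← lintegral_indicator_one (hB.inter measurableSet_Ici)]
  refine lintegral_congr fun z => ?_
  rw [Set.inter_indicator_one]
  rfl

theorem conv_mono_left {μ μ' ν : Measure ℝ} [SFinite ν] (h : μ ≤ μ') : μ ∗ ν ≤ μ' ∗ ν := by
  refine Measure.le_iff.2 fun B hB => ?_
  rw [← lintegral_indicator_one hB, ← lintegral_indicator_one hB,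
    Measure.lintegral_conv (measurable_one.indicator hB),
    Measure.lintegral_conv (measurable_one.indicator hB)]
  exact lintegral_mono' h le_rfl

theorem conv_sum_left {ρ : ℕ → Measure ℝ} [∀ i, SFinite (ρ i)] {ν : Measure ℝ} [SFinite ν] (N : ℕ) :
    (∑ i ∈ Finset.range N, ρ i) ∗ ν = ∑ i ∈ Finset.range N, ρ i ∗ ν := by
  have : ∀ N, SFinite (∑ i ∈ Finset.range N, ρ i) := by
    intro N
    induction N with
    | zero => simpa using inferInstanceAs (SFinite (0 : Measure ℝ))
    | succ N ih => rw [Finset.sum_range_succ]; infer_instance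
  induction N with
  | zero => simp
  | succ N ih =>
    have := this N
    rw [Finset.sum_range_succ, Measure.add_conv, ih, Finset.sum_range_succ]

/-- Lebesgue measure on the half-line is a fixed point of the renewal map `μ ↦ expMeasure 1 + μ ∗
expMeasure 1`, which is monotone and sends each partial sum to the next. -/
theorem sum_le_of_renewal {ρ : ℕ → Measure ℝ} [∀ i, SFinite (ρ i)] (h0 : ρ 0 = expMeasure 1)
    (hsucc : ∀ i, ρ (i + 1) = ρ i ∗ expMeasure 1) (N : ℕ) :
    ∑ i ∈ Finset.range N, ρ i ≤ volume.restrict (Set.Ici 0) := by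
  have := isProbabilityMeasure_expMeasure one_pos
  induction N with
  | zero => simpa using Measure.zero_le _
  | succ N ih =>
    rw [Finset.sum_range_succ', h0]
    simp_rw [hsucc]
    rw [← conv_sum_left, add_comm, ← expMeasure_add_conv]
    exact add_le_add le_rfl (conv_mono_left ih)

section Arrivals

variable {Ω : Type*} [MeasurableSpace Ω] {P : Measure Ω}

/-- Arrival times with exponential gaps hit an interval with a probability bounded by its length,
jointly with independent events of a given probability. -/
theorem measure_exists_arrival_le {g v : ℕ → Ω → ℝ} (hg : ∀ i, Measurable (g i))
    (hexp : ∀ i, HasLaw (g i) (expMeasure 1) P)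
    (hsucc : ∀ i, IndepFun (fun ω => ∑ j ∈ Finset.range (i + 1), g j ω) (g (i + 1)) P)
    (hmark : ∀ i, IndepFun (fun ω => ∑ j ∈ Finset.range (i + 1), g j ω) (v i) P)
    {D : Set ℝ} (hD : MeasurableSet D) {p : ℝ≥0∞} (hp : ∀ i, P (v i ⁻¹' D) ≤ p) (a b : ℝ) :
    P {ω | ∃ i, ∑ j ∈ Finset.range (i + 1), g j ω ∈ Set.Ioc a b ∧ v i ω ∈ D} ≤
      p * ENNReal.ofReal (b - a) := by
  have := isProbabilityMeasure_expMeasure one_pos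
  have : IsProbabilityMeasure P := (hexp 0).isProbabilityMeasure
  set s : ℕ → Ω → ℝ := fun i ω => ∑ j ∈ Finset.range (i + 1), g j ω with hs
  have hsm : ∀ i, Measurable (s i) := fun i => Finset.measurable_fun_sum _ fun j _ => hg j
  set ρ : ℕ → Measure ℝ := fun i => P.map (s i) with hρ
  have hρ0 : ρ 0 = expMeasure 1 := by
    have : s 0 = g 0 := by
      funext ω
      simp [hs]
    rw [hρ]
    simp only [this]
    exact (hexp 0).map_eq
  have hρs : ∀ i, ρ (i + 1) = ρ i ∗ expMeasure 1 := by
    intro i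
    have : s (i + 1) = s i + g (i + 1) := by
      funext ω
      exact Finset.sum_range_succ (fun j => g j ω) (i + 1)
    simp only [hρ, this]
    rw [(hsucc i).map_add_eq_map_conv_map (hsm i) (hg _), (hexp _).map_eq]
  have hsum := sum_le_of_renewal hρ0 hρs
  have hset : {ω | ∃ i, s i ω ∈ Set.Ioc a b ∧ v i ω ∈ D} =
      ⋃ i, s i ⁻¹' Set.Ioc a b ∩ v i ⁻¹' D := by
    ext ω
    simp
  calc P {ω | ∃ i, s i ω ∈ Set.Ioc a b ∧ v i ω ∈ D}
      ≤ ∑' i, P (s i ⁻¹' Set.Ioc a b ∩ v i ⁻¹' D) := hset ▸ measure_iUnion_le _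
    _ ≤ ∑' i, p * ρ i (Set.Ioc a b) := by
      refine ENNReal.tsum_le_tsum fun i => ?_
      rw [(hmark i).measure_inter_preimage_eq_mul _ _ measurableSet_Ioc hD, mul_comm,
        hρ, Measure.map_apply (hsm i) measurableSet_Ioc]
      gcongr
      exact hp i
    _ = p * ∑' i, ρ i (Set.Ioc a b) := ENNReal.tsum_mul_left
    _ ≤ p * ENNReal.ofReal (b - a) := by
      gcongr
      refine ENNReal.tsum_le_of_sum_range_le fun N => ?_
      have := hsum N (Set.Ioc a b)
      rw [Measure.finsetSum_apply] at this
      exact this.trans ((Measure.restrict_apply_le _ _).trans (by rw [Real.volume_Ioc]))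

/-! ### Independence of disjoint blocks of variables -/

variable {ι : Type*} {Y : ι → Ω → ℝ}

/-- The information carried by the variables with index in `S`. -/
abbrev info {Ω : Type*} (Y : ι → Ω → ℝ) (S : Set ι) : MeasurableSpace Ω :=
  ⨆ k ∈ S, MeasurableSpace.comap (Y k) inferInstance

theorem measurable_info {Ω : Type*} {Y : ι → Ω → ℝ} {S : Set ι} {k : ι} (hk : k ∈ S) : Measurable[info Y S] (Y k) :=
  measurable_iff_comap_le.2 (le_iSup₂_of_le (f := fun k (_ : k ∈ S) =>
    MeasurableSpace.comap (Y k) (inferInstance : MeasurableSpace ℝ)) k hk le_rfl)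

theorem info_mono {Ω : Type*} {Y : ι → Ω → ℝ} {S T : Set ι} (h : S ⊆ T) : info Y S ≤ info Y T :=
  biSup_mono h

theorem indep_info (hY : ∀ k, Measurable (Y k)) (h : iIndepFun Y P) {S T : Set ι}
    (hST : Disjoint S T) : Indep (info Y S) (info Y T) P :=
  indep_iSup_of_disjoint (fun k => (hY k).comap_le) h.iIndep hST

theorem indepFun_of_info (hY : ∀ k, Measurable (Y k)) (h : iIndepFun Y P) {S T : Set ι}
    (hST : Disjoint S T) {f g : Ω → ℝ} (hf : Measurable[info Y S] f)
    (hg : Measurable[info Y T] g) : IndepFun f g P :=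
  (IndepFun_iff_Indep _ _ _).2 (indep_of_indep_of_le (indep_info hY h hST) hf.comap_le hg.comap_le)

theorem measure_forall_mem_le {κ : Type*} (hY : ∀ k, Measurable (Y k)) (h : iIndepFun Y P)
    [IsProbabilityMeasure P]
    {T : κ → Set ι} (hT : Pairwise fun x y => Disjoint (T x) (T y)) {E : κ → Set Ω}
    (hE : ∀ x, MeasurableSet[info Y (T x)] (E x)) {p : ℝ≥0∞} (hp : ∀ x, P (E x) ≤ p)
    (S : Finset κ) : P {ω | ∀ x ∈ S, ω ∈ E x} ≤ p ^ S.card := by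
  classical
  -- The induction also carries measurability with respect to the union of the blocks, so that the
  -- next block is independent of the whole intersection.
  have key : MeasurableSet[info Y (⋃ x ∈ S, T x)] {ω | ∀ x ∈ S, ω ∈ E x} ∧
      P {ω | ∀ x ∈ S, ω ∈ E x} ≤ p ^ S.card := by
    induction S using Finset.induction_on with
    | empty => simp
    | insert x S hx ih =>
      have hset : {ω | ∀ y ∈ insert x S, ω ∈ E y} = E x ∩ {ω | ∀ y ∈ S, ω ∈ E y} := by
        ext ω
        simp
      have hdisj : Disjoint (T x) (⋃ y ∈ S, T y) := by
        refine Set.disjoint_iUnion₂_right.2 fun y hy => hT ?_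
        rintro rfl
        exact hx hy
      rw [hset]
      refine ⟨MeasurableSet.inter (info_mono ?_ _ (hE x)) (info_mono ?_ _ ih.1), ?_⟩
      · exact Set.subset_biUnion_of_mem (u := T) (Finset.mem_insert_self x S)
      · exact Set.biUnion_subset_biUnion_left fun y hy => Finset.mem_insert_of_mem hy
      · rw [(Indep_iff _ _ P).1 (indep_info hY h hdisj) _ _ (hE x) ih.1,
          Finset.card_insert_of_notMem hx, pow_succ']
        exact mul_le_mul' (hp x) ih.2
  exact key.2

end Arrivals

/-! ### The environment of the graphical construction -/

/-- The times at which the clock of `x` rings with a mark that is accepted when `x` has at most `m`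
occupied neighbours. -/
def offers {d : ℕ} (c : ℕ → ℝ) (τ u : Site d → ℕ → ℝ) : Site d → ℕ → Set ℝ :=
  fun x m => {r | ∃ i, r = τ x i ∧ ∃ k ≤ m, u x i ≤ c k}

section Graphical

variable {Ω : Type*} [MeasurableSpace Ω] {P : Measure Ω} {d : ℕ}

theorem eq_sum_gap {Ω : Type*} (τ : Site d → ℕ → Ω → ℝ) (x : Site d) (i : ℕ) (ω : Ω) :
    τ x i ω = ∑ j ∈ Finset.range (i + 1), gap τ x j ω := by
  induction i with
  | zero => simp [gap]
  | succ i ih =>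
    rw [Finset.sum_range_succ, ← ih]
    simp [gap]

theorem expMeasure_Iic_zero : expMeasure 1 (Set.Iic 0) = 0 := by
  rw [expMeasure_eq_withDensity, withDensity_apply _ measurableSet_Iic,
    lintegral_exponentialPDF_eq_antiDeriv one_pos]
  simp

theorem volume_Icc_restrict_Iic_le (r : ℝ) :
    volume.restrict (Set.Icc (0 : ℝ) 1) (Set.Iic r) ≤ ENNReal.ofReal r := by
  rw [Measure.restrict_apply measurableSet_Iic]
  refine (measure_mono (t := Set.Icc 0 r) fun y hy => ⟨hy.2.1, hy.1⟩).trans ?_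
  rw [Real.volume_Icc, sub_zero]

/-- Distinct sites use disjoint blocks of gaps and marks, and `measure_exists_arrival_le` treats
each site. The given variables are only almost everywhere measurable, hence the measurable versions
`s` and `v`, chosen before the rates so that they serve all `β`. -/
theorem IsGraphicalConstruction.exists_isEnvironment [IsProbabilityMeasure P]
    {τ U : Site d → ℕ → Ω → ℝ} (h : IsGraphicalConstruction P τ U) :
    ∃ s v : Site d → ℕ → Ω → ℝ,
      (∀ᵐ ω ∂P, ∀ x i, τ x i ω = s x i ω ∧ U x i ω = v x i ω ∧ 0 < s x i ω) ∧
      ∀ c : ℕ → ℝ, (∀ m ≤ d, 0 ≤ c m) → (∀ k m, k ≤ m → m ≤ d → c k ≤ c m) →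
        IsEnvironment P (fun ω => offers c (fun x i => s x i ω) fun x i => v x i ω) c := by
  set Z : (Site d × ℕ) ⊕ (Site d × ℕ) → Ω → ℝ :=
    Sum.elim (fun p : Site d × ℕ => gap τ p.1 p.2) (fun p : Site d × ℕ => U p.1 p.2) with hZ
  have hae : ∀ k, AEMeasurable (Z k) P := by
    rintro (p | p)
    · exact (h.exponential p.1 p.2).aemeasurable
    · exact (h.uniform p.1 p.2).aemeasurable
  set Y : (Site d × ℕ) ⊕ (Site d × ℕ) → Ω → ℝ := fun k => (hae k).mk (Z k) with hY
  have hYm : ∀ k, Measurable (Y k) := fun k => (hae k).measurable_mk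
  have hYZ : ∀ k, Z k =ᵐ[P] Y k := fun k => (hae k).ae_eq_mk
  have hYi : iIndepFun Y P := (iIndepFun_congr hYZ).1 h.indep
  have hexp : ∀ x i, HasLaw (Y (.inl (x, i))) (expMeasure 1) P := fun x i =>
    (h.exponential x i).congr (hYZ (.inl (x, i))).symm
  have hunif : ∀ x i, HasLaw (Y (.inr (x, i))) (volume.restrict (Set.Icc (0 : ℝ) 1)) P :=
    fun x i => (h.uniform x i).congr (hYZ (.inr (x, i))).symm
  set s : Site d → ℕ → Ω → ℝ := fun x i ω => ∑ j ∈ Finset.range (i + 1), Y (.inl (x, j)) ω with hs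
  have hsinfo : ∀ x i (S : Set ((Site d × ℕ) ⊕ (Site d × ℕ))), (∀ j ≤ i, .inl (x, j) ∈ S) →
      Measurable[info Y S] (s x i) := by
    intro x i S hS
    refine Finset.measurable_fun_sum _ fun j hj => measurable_info (hS j ?_)
    exact Nat.lt_succ_iff.1 (Finset.mem_range.1 hj)
  refine ⟨s, fun x i => Y (.inr (x, i)), ?_, fun c hc0 hc => ⟨fun ω x m m' hm => ?_, ?_⟩⟩
  · have hpos : ∀ x i, ∀ᵐ ω ∂P, 0 < Y (.inl (x, i)) ω := by
      intro x i
      have := (hexp x i).measure_eq (p := fun y => y ≤ 0) measurableSet_Iic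
      rw [ae_iff]
      simp only [not_lt]
      exact this.trans expMeasure_Iic_zero
    filter_upwards [ae_all_iff.2 hYZ, ae_all_iff.2 fun x => ae_all_iff.2 (hpos x)] with ω h1 h2 x i
    refine ⟨?_, h1 (.inr (x, i)), Finset.sum_pos (fun j _ => h2 x j) ⟨0, by simp⟩⟩
    exact (eq_sum_gap τ x i ω).trans (Finset.sum_congr rfl fun j _ => h1 (.inl (x, j)))
  · rintro r ⟨i, hr, k, hk, hu⟩
    exact ⟨i, hr, k, hk.trans hm, hu⟩
  · intro m hm a b S
    set E : Site d → Set Ω := fun x =>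
      {ω | ∃ i, s x i ω ∈ Set.Ioc a b ∧ Y (.inr (x, i)) ω ∈ Set.Iic (c m)} with hE
    set T : Site d → Set ((Site d × ℕ) ⊕ (Site d × ℕ)) := fun x =>
      {k | Sum.elim Prod.fst Prod.fst k = x} with hT
    have hsub : {ω | ∀ y ∈ S, (offers c (fun x i => s x i ω) (fun x i => Y (.inr (x, i)) ω) y m ∩
        Set.Ioc a b).Nonempty} ⊆ {ω | ∀ y ∈ S, ω ∈ E y} := by
      intro ω hω y hy
      obtain ⟨r, ⟨i, rfl, k, hk, hu⟩, hr⟩ := hω y hy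
      exact ⟨i, hr, hu.trans (hc k m hk hm)⟩
    refine (measure_mono hsub).trans (measure_forall_mem_le hYm hYi (T := T) ?_ ?_ ?_ S)
    · intro x y hxy
      exact Set.disjoint_left.2 fun k hk hk' => hxy (hk.symm.trans hk')
    · intro x
      have : E x = ⋃ i, s x i ⁻¹' Set.Ioc a b ∩ Y (.inr (x, i)) ⁻¹' Set.Iic (c m) := by
        ext ω
        simp [hE]
      rw [this]
      refine MeasurableSet.iUnion fun i => MeasurableSet.inter ?_ ?_
      · exact hsinfo x i (T x) (fun _ _ => rfl) measurableSet_Ioc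
      · exact (measurable_info (Y := Y) (S := T x) (k := .inr (x, i)) rfl) measurableSet_Iic
    · intro x
      refine (measure_exists_arrival_le (g := fun i => Y (.inl (x, i)))
        (v := fun i => Y (.inr (x, i))) (fun i => hYm _) (hexp x) (fun i => ?_) (fun i => ?_)
        measurableSet_Iic (p := ENNReal.ofReal (c m)) (fun i => ?_) a b).trans ?_
      · refine indepFun_of_info hYm hYi (S := {k | ∃ j ≤ i, k = .inl (x, j)})
          (T := {.inl (x, i + 1)}) ?_ (hsinfo x i _ fun j hj => ⟨j, hj, rfl⟩) (measurable_info rfl)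
        rw [Set.disjoint_singleton_right]
        rintro ⟨j, hj, hjk⟩
        simp at hjk
        omega
      · refine indepFun_of_info hYm hYi (S := {k | ∃ j ≤ i, k = .inl (x, j)})
          (T := {.inr (x, i)}) ?_ (hsinfo x i _ fun j hj => ⟨j, hj, rfl⟩) (measurable_info rfl)
        rw [Set.disjoint_singleton_right]
        rintro ⟨j, hj, hjk⟩
        simp at hjk
      · have := (hunif x i).measure_eq (p := fun y => y ≤ c m) measurableSet_Iic
        exact this.trans_le (volume_Icc_restrict_Iic_le _)
      · rw [ENNReal.ofReal_mul (hc0 m hm)]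

end Graphical

/-! ### Clusters of the growth process -/

theorem isLinked_of_isCluster {d : ℕ} {A C : Set (Site d)} (hC : IsCluster A C)
    {D : Finset (Site d)} (hD : (D : Set (Site d)) = C) : IsLinked D := by
  obtain ⟨K, rfl⟩ := hC
  have hmem : ∀ z : A, z ∈ K.supp → z.1 ∈ D := fun z hz => by
    rw [← Finset.mem_coe, hD]
    exact ⟨z, hz, rfl⟩
  intro x hx y hy
  rw [← Finset.mem_coe, hD] at hx hy
  obtain ⟨x, hx, rfl⟩ := hx
  obtain ⟨y, hy, rfl⟩ := hy
  have hreach : ((lattice d).induce A).Reachable x y :=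
    SimpleGraph.ConnectedComponent.exact (hx.trans hy.symm)
  rw [SimpleGraph.reachable_iff_reflTransGen] at hreach
  clear hy
  have key : Linked D x.1 y.1 ∧ y ∈ K.supp := by
    induction hreach with
    | refl => exact ⟨.refl, hx⟩
    | @tail u v _ huv ih =>
      have hv : v ∈ K.supp := (K.mem_supp_congr_adj huv).1 ih.2
      exact ⟨ih.1.tail ⟨hmem _ ih.2, hmem _ hv, huv⟩, hv⟩
  exact key.1

theorem mem_of_isCluster_of_adj {d : ℕ} {A C : Set (Site d)} (hC : IsCluster A C) {x y : Site d}
    (hx : x ∈ C) (hy : y ∈ A) (h : (lattice d).Adj x y) : y ∈ C := by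
  obtain ⟨K, rfl⟩ := hC
  obtain ⟨x, hx, rfl⟩ := hx
  have hxy : ((lattice d).induce A).Adj x ⟨y, hy⟩ := h
  exact ⟨⟨y, hy⟩, (K.mem_supp_congr_adj hxy).1 hx, rfl⟩

/-- A large cluster of the growth process is filled from inside. -/
theorem hasLarge_of_isCluster {d : ℕ} {Λ : Finset (Site d)} {c : ℕ → ℝ} {τ u : Site d → ℕ → ℝ}
    {t l : ℝ} (hτ : ∀ x i, 0 < τ x i) {C : Set (Site d)} (hC : IsCluster (growth Λ c τ u t) C)
    (hl : 0 ≤ l) (hlt : l < Metric.diam C) : HasLarge (offers c τ u) Λ 0 t l := by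
  classical
  have hCA : C ⊆ growth Λ c τ u t := by
    obtain ⟨K, rfl⟩ := hC
    rintro _ ⟨x, _, rfl⟩
    exact x.2
  obtain ⟨x₀, hx₀, y₀, hy₀, hxy₀⟩ : ∃ x ∈ C, ∃ y ∈ C, l < dist x y := by
    by_contra! hcon
    exact absurd hlt (not_lt.2 (Metric.diam_le_of_forall_dist_le hl hcon))
  have hchron : Chronological Λ τ := (hCA hx₀).2.1
  -- The schedule is the time of the first successful arrival, which exists by well-foundedness.
  have hfirst : ∀ x, ∃ r, ∀ hx : x ∈ Λ, ∀ i, Success Λ c τ u hchron (⟨x, hx⟩, i) →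
      r ≤ τ x i ∧ ∃ j, r = τ x j ∧ Success Λ c τ u hchron (⟨x, hx⟩, j) := by
    intro x
    by_cases hx : ∃ (hx : x ∈ Λ) (i : ℕ), Success Λ c τ u hchron (⟨x, hx⟩, i)
    · obtain ⟨hx, i, hi⟩ := hx
      obtain ⟨⟨⟨y, hy⟩, j⟩, ⟨hyx, hj⟩, hmin⟩ := hchron.has_min
        {e : Λ × ℕ | e.1.1 = x ∧ Success Λ c τ u hchron e} ⟨_, rfl, hi⟩
      obtain rfl : y = x := hyx
      exact ⟨τ y j, fun _ k hk => ⟨not_lt.1 (hmin (⟨y, hy⟩, k) ⟨rfl, hk⟩), j, rfl, hj⟩⟩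
    · exact ⟨0, fun hx' i hi => absurd ⟨hx', i, hi⟩ hx⟩
  choose s hs using hfirst
  set D : Finset (Site d) := Λ.filter (· ∈ C) with hD
  have hDC : (D : Set (Site d)) = C := by
    ext x
    simp only [hD, Finset.coe_filter, Set.mem_ofPred_eq, and_iff_right_iff_imp]
    exact fun hx => (hCA hx).1
  have hmemD : ∀ {x}, x ∈ D ↔ x ∈ C := fun {x} => by rw [← Finset.mem_coe, hDC]
  refine ⟨D, Finset.filter_subset _ _, s, isLinked_of_isCluster hC hDC, ⟨fun x hx => ?_,
    fun x hx => ?_⟩, x₀, hmemD.2 hx₀, y₀, hmemD.2 hy₀, hxy₀⟩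
  · obtain ⟨hxΛ, _, i, hit, hi⟩ := hCA (hmemD.1 hx)
    obtain ⟨hsi, j, hsj, hj⟩ := hs x hxΛ i hi
    -- The neighbours counted by the updating rule are still occupied at time `t`, so they belong to
    -- the same cluster, and their first successes precede that of `x`.
    refine ⟨j, hsj, _, ?_, Iff.mp (Iff.of_eq (WellFounded.fix_eq hchron _ _)) hj⟩
    rw [← Set.ncard_image_of_injective _ Subtype.val_injective, ← Set.ncard_coe_finset]
    refine Set.ncard_le_ncard ?_ (Finset.finite_toSet _)
    rintro _ ⟨y, ⟨hadj, k, hk, hsucc⟩, rfl⟩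
    have hlt : τ y.1 k < τ x j := hk
    have hsucc : Success Λ c τ u hchron (y, k) := hsucc
    refine Finset.mem_coe.2 (mem_earlier.2 ⟨hmemD.2 ?_, hadj, ?_⟩)
    · refine mem_of_isCluster_of_adj hC (hmemD.1 hx) ⟨y.2, hchron, k, ?_, hsucc⟩ hadj
      linarith
    · exact (hs y.1 y.2 k hsucc).1.trans_lt (hsj ▸ hlt)
  · obtain ⟨hxΛ, _, i, hit, hi⟩ := hCA (hmemD.1 hx)
    obtain ⟨hsi, j, hsj, hj⟩ := hs x hxΛ i hi
    exact ⟨hsj ▸ hτ x j, hsi.trans hit⟩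

theorem card_box_le (d : ℕ) {ℓ : ℝ} (hℓ : 1 ≤ ℓ) : ((box d ℓ).card : ℝ) ≤ (2 * ℓ) ^ d := by
  rw [box, Fintype.card_piFinset, Finset.prod_const, Finset.card_univ, Fintype.card_fin]
  push_cast
  refine pow_le_pow_left₀ (by positivity) ?_ d
  have h0 : 0 ≤ ⌊ℓ / 2⌋ := Int.floor_nonneg.2 (by linarith)
  rw [Int.card_Icc, Int.ceil_neg]
  have : ((⌊ℓ / 2⌋ + 1 - -⌊ℓ / 2⌋).toNat : ℤ) = 2 * ⌊ℓ / 2⌋ + 1 := by omega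
  have : ((⌊ℓ / 2⌋ + 1 - -⌊ℓ / 2⌋).toNat : ℝ) = 2 * ⌊ℓ / 2⌋ + 1 := by exact_mod_cast this
  rw [this]
  linarith [Int.floor_le (ℓ / 2)]

theorem RateHypothesis.eventually_le {d : ℕ} {c : ℝ → ℕ → ℝ} {Γ : ℕ → ℝ}
    (h : RateHypothesis d c Γ) {ε : ℝ} (hε : 0 < ε) :
    ∀ᶠ β : ℝ in atTop, ∀ m ≤ d, c β m ≤ Real.exp (-(β * (Γ (d - m) - ε))) := by
  have : ∀ᶠ β : ℝ in atTop, ∀ m ∈ Finset.range (d + 1),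
      c β m ≤ Real.exp (-(β * (Γ (d - m) - ε))) := by
    refine (Filter.eventually_all_finset _).2 fun m hm => ?_
    have hm : m ≤ d := Nat.lt_succ_iff.1 (Finset.mem_range.1 hm)
    filter_upwards [(h.limit_low m hm).eventually_lt_const (u := -Γ (d - m) + ε) (by linarith),
      eventually_gt_atTop 0] with β hβ hβ0
    rw [← Real.log_le_iff_le_exp (h.pos β hβ0 m (by omega))]
    rw [one_div, inv_mul_lt_iff₀ hβ0] at hβ
    linarith
  filter_upwards [this] with β hβ m hm using hβ m (Finset.mem_range.2 (by omega))

theorem SES_of_le {p : ℝ → ℝ≥0∞}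
    (h : ∀ A : ℝ, ∀ᶠ β : ℝ in atTop, p β ≤ ENNReal.ofReal (Real.exp (-(β * A)))) : SES p := by
  refine EReal.tendsto_nhds_bot_iff_real.2 fun x => ?_
  filter_upwards [h (1 - x), eventually_gt_atTop 0] with β hβ hβ0
  have h1 : ENNReal.log (p β) ≤ ((-(β * (1 - x)) : ℝ) : EReal) := by
    refine (ENNReal.log_le_log hβ).trans ?_
    rw [ENNReal.log_ofReal_of_pos (Real.exp_pos _), Real.log_exp]
  have h2 : (0 : EReal) ≤ ((1 / β : ℝ) : EReal) := by
    exact_mod_cast (one_div_pos.2 hβ0).le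
  refine (mul_le_mul_of_nonneg_left h1 h2).trans_lt ?_
  rw [← EReal.coe_mul, EReal.coe_lt_coe_iff]
  have : 1 / β * -(β * (1 - x)) = x - 1 := by
    field_simp
    ring
  linarith

end NucleationGrowth

theorem theoremT2 (d : ℕ) (c : ℝ → ℕ → ℝ) (Γ : ℕ → ℝ)
    (hrates : NucleationGrowth.RateHypothesis d c Γ)
    (hLd : 0 < d → 0 < NucleationGrowth.critL Γ d)
    {Ω : Type*} [MeasurableSpace Ω] (P : Measure Ω) [IsProbabilityMeasure P]
    (τ U : NucleationGrowth.Site d → ℕ → Ω → ℝ)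
    (hτU : NucleationGrowth.IsGraphicalConstruction P τ U)
    (L : ℝ) (hL : 0 < L) (κ : ℝ) (hκ : κ < NucleationGrowth.kappa Γ d) :
    NucleationGrowth.SES fun β : ℝ =>
      P {ω | ∃ C : Set (NucleationGrowth.Site d),
        NucleationGrowth.IsCluster
          (NucleationGrowth.growth (NucleationGrowth.box d (Real.exp (β * L))) (c β)
            (fun x i => τ x i ω) (fun x i => U x i ω) (Real.exp (β * κ))) C ∧
        Real.exp (β * NucleationGrowth.critL Γ d) < Metric.diam C} := by
  open NucleationGrowth in
  refine SES_of_le fun A => ?_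
  rcases Nat.eq_zero_or_pos d with rfl | hd
  · refine Eventually.of_forall fun β => ?_
    have hempty : {ω | ∃ C : Set (Site 0), IsCluster (growth (box 0 (Real.exp (β * L))) (c β)
        (fun x i => τ x i ω) (fun x i => U x i ω) (Real.exp (β * κ))) C ∧
        Real.exp (β * critL Γ 0) < Metric.diam C} = ∅ := by
      ext ω
      simp only [Set.mem_ofPred_eq, Set.mem_empty_iff_false, iff_false]
      rintro ⟨C, _, hC⟩
      rw [Metric.diam_subsingleton Set.subsingleton_of_subsingleton] at hC
      exact absurd hC (not_lt.2 (Real.exp_pos _).le)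
    rw [hempty, measure_empty]
    exact zero_le
  have hΓ : ∀ k < d, Γ k ≤ Γ (k + 1) := fun k hk => hrates.energies k (k + 1) (by omega) hk
  obtain ⟨ε, hε, lam, hlam, -, hlam', H⟩ := largeUnlikely P d Γ hΓ κ hκ
  -- A strict inequality of exponents lets `exp (β * critL Γ d)` dominate `M * exp (β * lam)`. When
  -- `lam = 0` it is the hypothesis `hLd`.
  have hlt : 0 < critL Γ d - lam := by
    rcases hlam' with rfl | h
    · simpa using hLd hd
    · rw [sub_pos, critL, lt_div_iff₀ (by exact_mod_cast hd)]
      linarith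
  -- The extra `1` in the exponent absorbs the factor `2 ^ d` in the volume of the box.
  obtain ⟨M, -, hβ⟩ := H A (d * L + 1)
  obtain ⟨s, v, hsv, henv⟩ := hτU.exists_isEnvironment
  filter_upwards [hβ, eventually_gt_atTop 0, hrates.eventually_le hε, eventually_le_exp M hlt,
    eventually_le_exp (2 ^ d) one_pos] with β hβ hβ0 hc hM h2
  have henvβ := (henv (c β) (fun m hm => (hrates.pos β hβ0 m (by omega)).le)
    fun k m hkm hm => hrates.mono β hβ0 k m hkm (by omega)).mono_rate
    (fun m hm => (hrates.pos β hβ0 m (by omega)).le) hc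
  have hcard : ((box d (Real.exp (β * L))).card : ℝ) ≤ Real.exp (β * (d * L + 1)) := by
    refine (card_box_le d (Real.one_le_exp (by positivity))).trans ?_
    rw [mul_pow, ← Real.exp_nat_mul]
    refine (mul_le_mul_of_nonneg_right h2 (Real.exp_pos _).le).trans (le_of_eq ?_)
    rw [← Real.exp_add]
    ring_nf
  refine le_trans (measure_mono_ae ?_) (hβ _ henvβ _ hcard 0 (Real.exp (β * κ)) (by simp))
  filter_upwards [hsv] with ω hω
  rintro ⟨C, hC, hdiam⟩
  have hτs : (fun x i => τ x i ω) = fun x i => s x i ω := by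
    funext x i
    exact (hω x i).1
  have hUv : (fun x i => U x i ω) = fun x i => v x i ω := by
    funext x i
    exact (hω x i).2.1
  rw [hτs, hUv] at hC
  obtain ⟨D, hD, t, h1, h3, x, hx, y, hy, hxy⟩ :=
    hasLarge_of_isCluster (fun x i => (hω x i).2.2) hC (Real.exp_pos _).le hdiam
  refine ⟨D, hD, t, h1, h3, x, hx, y, hy, lt_of_le_of_lt ?_ hxy⟩
  refine (mul_le_mul_of_nonneg_right hM (Real.exp_pos _).le).trans (le_of_eq ?_)
  rw [← Real.exp_add]
  ring_nf
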